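/- Let $\mathbb T$ be the unit circle. A \emph{Beurling weight} is a two-sided sequence $\nu=\{\nu(n)\}_{n\in\mathbb Z}$ of real numbers with $\nu(0)=1$, $\nu(n)\ge 1$, $\nu(n)=\nu(-n)$ and $\nu(n+m)\le\nu(n)\nu(m)$ for all $n,m\in\mathbb Z$. Let $\ell_\nu$ be the space of complex sequences $a=\{a_n\}_{n\in\mathbb Z}$ with $\sum_n\nu(n)|a_n|<\infty$; a one-sided sequence is completed by zeros. Let $\mathcal A_\nu$ be the space of functions $f(z)=\sum_{k\in\mathbb Z}f_kz^k$ on $\mathbb T$ with $\|f\|_\nu=\sum_k\nu(k)|f_k|<\infty$, and let $\mathcal A_\nu^-$ be the set of $f\in\mathcal A_\nu$ with $f_k=0$ for $k>0$; $\mathcal A_1$ is the Wiener algebra ($\nu\equiv1$). For $f\in\mathcal A_1$ put $\mathcal P_-(f)=\sum_{k\le 0}f_kz^k$. Let $d\mu=w(\theta)\,d\theta$ with $w\in\mathcal A_1$ strictly positive on $\mathbb T$. Let $\varphi_n(z)=\kappa_nz^n+\cdots$, $\kappa_n>0$, be the orthonormal polynomials, $\frac1{2\pi}\int_{-\pi}^{\pi}\varphi_n(e^{i\theta})\overline{\varphi_m(e^{i\theta})}\,d\mu=\delta_{n,m}$,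 let $\varphi_n^*(z)=z^n\overline{\varphi_n(1/\bar z)}$, and let $\alpha=\{\alpha_n\}_{n\ge0}$ be the Verblunsky coefficients, given by $\varphi_{n+1}(z)=(1-|\alpha_n|^2)^{-1/2}\bigl(z\varphi_n(z)-\overline{\alpha_n}\,\varphi_n^*(z)\bigr)$, equivalently $\alpha_n=-\overline{\varphi_{n+1}(0)}/\kappa_{n+1}$. Then the limits $f_+=\lim_n\varphi_n^*$ and $f_-=\lim_n z^{-n}\varphi_n$ exist in the norm of $\mathcal A_1$, $f_+$ has no zeros on $\mathbb T$, and the scattering function $\mathcal S=f_- /f_+$ belongs to $\mathcal A_1$. Moreover, for every Beurling weight $\nu$, $$\alpha\in\ell_\nu\quad\Longleftrightarrow\quad\mathcal P_-(\mathcal S)\in\mathcal A_\nu^-.$$ -/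

import Mathlib

open MeasureTheory Filter Topology Polynomial
open scoped ComplexConjugate Real

namespace OPUC

noncomputable section

/-! ### Beurling weights, sequence spaces and Beurling algebras -/

/-- A Beurling weight: `ν 0 = 1`, `ν n ≥ 1`, `ν n = ν (-n)`, `ν (n + m) ≤ ν n * ν m`. -/
structure IsBeurlingWeight (ν : ℤ → ℝ) : Prop where
  map_zero : ν 0 = 1
  one_le : ∀ n, 1 ≤ ν n
  symm : ∀ n, ν n = ν (-n)
  submul : ∀ n m, ν (n + m) ≤ ν n * ν m

/-- The weighted space `ℓ_ν` of two-sided complex sequences: `∑ ν n |a n| < ∞`. -/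
def MemEll (ν : ℤ → ℝ) (a : ℤ → ℂ) : Prop :=
  Summable fun n => ν n * ‖a n‖

/-- A one-sided sequence, completed by zeros to a two-sided sequence. -/
def zeroExtend (a : ℕ → ℂ) : ℤ → ℂ :=
  fun k => if 0 ≤ k then a k.toNat else 0

/-- The unit circle, as the circle of angles `θ` modulo `2π`; its measure `volume` is `dθ`, of
total mass `2π`. -/
abbrev AngleCircle : Type := AddCircle (2 * π)

instance : Fact (0 < 2 * π) := ⟨Real.two_pi_pos⟩

/-- The point `e^{iθ}`. -/
def pt (θ : AngleCircle) : ℂ := (AddCircle.toCircle θ : ℂ)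

/-- The algebra `A_ν` of functions `f = ∑ f_k z^k` on the circle with `∑ ν k |f_k| < ∞`.
The coefficients `f_k = fourierCoeff f k` are `(1 / 2π) ∫ f(θ) e^{-ikθ} dθ`. -/
def MemA (ν : ℤ → ℝ) (f : AngleCircle → ℂ) : Prop :=
  MemEll ν (fourierCoeff f) ∧ ∀ θ, HasSum (fun k : ℤ => fourierCoeff f k * pt θ ^ k) (f θ)

/-- The norm of `A_ν`, for members of `A_ν`. -/
def normA (ν : ℤ → ℝ) (f : AngleCircle → ℂ) : ℝ :=
  ∑' k : ℤ, ν k * ‖fourierCoeff f k‖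

/-- `A_ν^+`: the members of `A_ν` with `f_k = 0` for `k < 0`. -/
def MemAPlus (ν : ℤ → ℝ) (f : AngleCircle → ℂ) : Prop :=
  MemA ν f ∧ ∀ k < 0, fourierCoeff f k = 0

/-- `A_ν^-`: the members of `A_ν` with `f_k = 0` for `k > 0`. -/
def MemAMinus (ν : ℤ → ℝ) (f : AngleCircle → ℂ) : Prop :=
  MemA ν f ∧ ∀ k > 0, fourierCoeff f k = 0

/-- The sequence `F n` of members of `A_ν` converges to the member `f` of `A_ν` in norm. -/
def TendstoA (ν : ℤ → ℝ) (F : ℕ → AngleCircle → ℂ) (f : AngleCircle → ℂ) : Prop :=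
  (∀ n, MemA ν (F n)) ∧ MemA ν f ∧ Tendsto (fun n => normA ν (F n - f)) atTop (𝓝 0)

/-- The projector `P_-` on two-sided sequences. -/
def seqProjMinus (d : ℤ → ℂ) : ℤ → ℂ :=
  fun n => if n ≤ 0 then d n else 0

/-- The projector `P_-` on functions, `P_-(∑ f_k z^k) = ∑_{k ≤ 0} f_k z^k`. -/
def projMinus (f : AngleCircle → ℂ) : AngleCircle → ℂ :=
  fun θ => ∑' k : ℤ, seqProjMinus (fourierCoeff f) k * pt θ ^ k

/-! ### Orthogonal polynomials on the unit circle -/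

/-- The inner product `(1 / 2π) ∫ p(e^{iθ}) conj (q(e^{iθ})) dμ(θ)`. -/
def ip (μ : Measure AngleCircle) (p q : ℂ[X]) : ℂ :=
  (2 * π : ℂ)⁻¹ * ∫ θ, p.eval (pt θ) * conj (q.eval (pt θ)) ∂μ

/-- The monic orthogonal polynomials `Φ_n`, by the Gram-Schmidt process applied to the
monomials. -/
def monicOP (μ : Measure AngleCircle) (n : ℕ) : ℂ[X] :=
  X ^ n - ∑ k : Fin n,
    C (ip μ (X ^ n) (monicOP μ k) / ip μ (monicOP μ k) (monicOP μ k)) * monicOP μ k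
termination_by n
decreasing_by all_goals exact k.isLt

/-- The leading coefficient `κ_n > 0` of `φ_n`. -/
def kappa (μ : Measure AngleCircle) (n : ℕ) : ℝ :=
  (√(ip μ (monicOP μ n) (monicOP μ n)).re)⁻¹

/-- The orthonormal polynomials `φ_n = κ_n Φ_n`. -/
def orthoPoly (μ : Measure AngleCircle) (n : ℕ) : ℂ[X] :=
  C (kappa μ n : ℂ) * monicOP μ n

/-- The reversed polynomial of order `n`, `p^*(z) = z^n conj p (1 / z)`, where `conj p` has the
conjugate coefficients. -/
def reversed (n : ℕ) (p : ℂ[X]) : ℂ[X] :=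
  (p.map (starRingEnd ℂ)).reflect n

/-- The Verblunsky coefficients `α_n = - conj (Φ_{n+1}(0))`. They are the recurrence
coefficients of the polynomials `φ_n`: see `orthoPoly_succ` below. -/
def verblunsky (μ : Measure AngleCircle) (n : ℕ) : ℂ :=
  -conj ((monicOP μ (n + 1)).eval 0)

/-! ### The scattering function -/

/-- The function `φ_n^*` on the circle. -/
def phiStar (μ : Measure AngleCircle) (n : ℕ) : AngleCircle → ℂ :=
  fun θ => (reversed n (orthoPoly μ n)).eval (pt θ)

/-- The function `z^{-n} φ_n(z)` on the circle. -/
def phiHat (μ : Measure AngleCircle) (n : ℕ) : AngleCircle → ℂ :=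
  fun θ => pt θ ^ (-(n : ℤ)) * (orthoPoly μ n).eval (pt θ)

/-- `f_+`, the limit of `φ_n^*`. -/
def fPlus (μ : Measure AngleCircle) : AngleCircle → ℂ :=
  fun θ => limUnder atTop fun n => phiStar μ n θ

/-- `f_-`, the limit of `z^{-n} φ_n(z)`. -/
def fMinus (μ : Measure AngleCircle) : AngleCircle → ℂ :=
  fun θ => limUnder atTop fun n => phiHat μ n θ

/-- The scattering function `S = f_- / f_+`. -/
def scattering (μ : Measure AngleCircle) : AngleCircle → ℂ :=
  fun θ => fMinus μ θ / fPlus μ θ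

/-- The measure `dμ = w dθ`. -/
def weightMeasure (w : AngleCircle → ℝ) : Measure AngleCircle :=
  volume.withDensity fun θ => ENNReal.ofReal (w θ)

/-! ### The polynomials are orthonormal and `verblunsky` gives their recurrence coefficients -/

section Recurrence

variable {μ : Measure AngleCircle}

theorem norm_pt (θ : AngleCircle) : ‖pt θ‖ = 1 := Circle.norm_coe _

theorem pt_ne_zero (θ : AngleCircle) : pt θ ≠ 0 := Circle.coe_ne_zero _

theorem continuous_pt : Continuous pt :=
  continuous_subtype_val.comp AddCircle.continuous_toCircle

theorem integrable_ip [IsFiniteMeasure μ] (p q : ℂ[X]) :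
    Integrable (fun θ => p.eval (pt θ) * conj (q.eval (pt θ))) μ := by
  have hc : Continuous fun θ => p.eval (pt θ) * conj (q.eval (pt θ)) :=
    (p.continuous.comp continuous_pt).mul
      (Complex.continuous_conj.comp (q.continuous.comp continuous_pt))
  exact hc.integrable_of_hasCompactSupport (HasCompactSupport.of_compactSpace _)

theorem ip_add_left [IsFiniteMeasure μ] (p q r : ℂ[X]) :
    ip μ (p + q) r = ip μ p r + ip μ q r := by
  simp only [ip, eval_add, add_mul]
  rw [integral_add (integrable_ip p r) (integrable_ip q r), mul_add]

theorem ip_C_mul_left (c : ℂ) (p q : ℂ[X]) : ip μ (C c * p) q = c * ip μ p q := by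
  simp only [ip, eval_mul, eval_C, mul_assoc]
  rw [integral_const_mul]
  ring

theorem ip_conj (p q : ℂ[X]) : conj (ip μ p q) = ip μ q p := by
  simp only [ip, map_mul]
  rw [← integral_conj]
  simp only [map_mul, Complex.conj_conj, map_inv₀, Complex.conj_ofReal, Complex.conj_ofNat]
  simp only [mul_comm (conj (p.eval _))]

/-- The inner product, as a linear map in its first argument. -/
def ipLin (μ : Measure AngleCircle) [IsFiniteMeasure μ] (r : ℂ[X]) : ℂ[X] →ₗ[ℂ] ℂ where
  toFun p := ip μ p r
  map_add' p q := ip_add_left p q r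
  map_smul' c p := by rw [smul_eq_C_mul, ip_C_mul_left]; rfl

theorem ip_sub_left [IsFiniteMeasure μ] (p q r : ℂ[X]) :
    ip μ (p - q) r = ip μ p r - ip μ q r := map_sub (ipLin μ r) p q

theorem ip_sum_left [IsFiniteMeasure μ] {ι : Type*} (s : Finset ι) (f : ι → ℂ[X]) (r : ℂ[X]) :
    ip μ (∑ i ∈ s, f i) r = ∑ i ∈ s, ip μ (f i) r := map_sum (ipLin μ r) f s

theorem ip_X_mul (p q : ℂ[X]) : ip μ (X * p) (X * q) = ip μ p q := by
  unfold ip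
  congr 2
  funext θ
  have h : pt θ * conj (pt θ) = 1 := by
    rw [Complex.mul_conj, Complex.normSq_eq_norm_sq, norm_pt]; simp
  simp only [eval_mul, eval_X, map_mul]
  linear_combination (p.eval (pt θ) * conj (q.eval (pt θ))) * h

theorem eval_reversed {n : ℕ} {p : ℂ[X]} (hp : p.natDegree ≤ n) (θ : AngleCircle) :
    (reversed n p).eval (pt θ) = pt θ ^ n * conj (p.eval (pt θ)) := by
  have hinv : (pt θ)⁻¹ = conj (pt θ) := Complex.inv_eq_conj (norm_pt θ)
  let _ : Invertible (conj (pt θ)) :=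
    invertibleOfNonzero (by simpa using pt_ne_zero θ)
  have h := eval₂_reflect_mul_pow (RingHom.id ℂ) (conj (pt θ)) n (p.map (starRingEnd ℂ))
    (natDegree_map_le.trans hp)
  rw [invOf_eq_inv, ← hinv, inv_inv, ← eval, hinv, ← eval, eval_map] at h
  have h2 : eval₂ (starRingEnd ℂ) (conj (pt θ)) p = conj (p.eval (pt θ)) := by
    rw [eval, hom_eval₂]; simp
  rw [h2] at h
  rw [reversed, ← h, ← hinv, mul_left_comm, ← mul_pow, mul_inv_cancel₀ (pt_ne_zero θ), one_pow,
    mul_one]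

theorem ip_reversed {n : ℕ} {p q : ℂ[X]} (hp : p.natDegree ≤ n) (hq : q.natDegree ≤ n) :
    ip μ (reversed n p) (reversed n q) = ip μ q p := by
  unfold ip
  congr 2
  funext θ
  have h : pt θ * conj (pt θ) = 1 := by
    rw [Complex.mul_conj, Complex.normSq_eq_norm_sq, norm_pt]; simp
  have h' : pt θ ^ n * conj (pt θ) ^ n = 1 := by rw [← mul_pow, h, one_pow]
  rw [eval_reversed hp, eval_reversed hq]
  simp only [map_mul, map_pow, Complex.conj_conj]
  linear_combination (q.eval (pt θ) * conj (p.eval (pt θ))) * h'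

theorem monicOP_eq (n : ℕ) : monicOP μ n = X ^ n - ∑ k : Fin n,
    C (ip μ (X ^ n) (monicOP μ k) / ip μ (monicOP μ k) (monicOP μ k)) * monicOP μ k := by
  rw [monicOP]

theorem monicOP_sub_degree (n : ℕ) :
    degree (monicOP μ n - (X ^ n : ℂ[X])) < (n : WithBot ℕ) := by
  induction n using Nat.strong_induction_on with
  | _ n ih =>
    rw [monicOP_eq, sub_sub_cancel_left, degree_neg]
    refine (degree_sum_le _ _).trans_lt ?_
    refine (Finset.sup_lt_iff (WithBot.bot_lt_coe n)).2 fun k _ => ?_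
    have hk : (monicOP μ k).degree ≤ (k : ℕ) := by
      have := (ih k k.isLt).le
      calc (monicOP μ k).degree = ((monicOP μ k - X ^ (k : ℕ)) + X ^ (k : ℕ)).degree := by simp
        _ ≤ _ := (degree_add_le _ _).trans (max_le this (degree_X_pow_le _))
    rw [← smul_eq_C_mul]
    refine (degree_smul_le _ _).trans_lt (hk.trans_lt ?_)
    exact Nat.cast_lt.2 k.isLt

theorem monicOP_degree (n : ℕ) : (monicOP μ n).degree = n := by
  have h := monicOP_sub_degree (μ := μ) n
  rw [← sub_add_cancel (monicOP μ n) (X ^ n), degree_add_eq_right_of_degree_lt]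
  · simp
  · simpa using h

theorem monicOP_natDegree (n : ℕ) : (monicOP μ n).natDegree = n :=
  natDegree_eq_of_degree_eq_some (monicOP_degree n)

theorem monicOP_coeff (n : ℕ) : (monicOP μ n).coeff n = 1 := by
  have h := coeff_eq_zero_of_degree_lt (monicOP_sub_degree (μ := μ) n)
  rw [coeff_sub, coeff_X_pow_self, sub_eq_zero] at h
  exact h

theorem ip_monicOP_of_lt [IsFiniteMeasure μ] (hμ : ∀ p, ip μ p p = 0 → p = 0) :
    ∀ n, ∀ m < n, ip μ (monicOP μ n) (monicOP μ m) = 0 := by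
  intro n
  induction n using Nat.strong_induction_on with
  | _ n ih =>
    intro m hm
    have h0 : ip μ (monicOP μ m) (monicOP μ m) ≠ 0 := fun h => by
      have := monicOP_coeff (μ := μ) m
      simp [hμ _ h] at this
    rw [monicOP_eq n, ip_sub_left, ip_sum_left, Finset.sum_eq_single (⟨m, hm⟩ : Fin n)]
    · rw [ip_C_mul_left, div_mul_cancel₀ _ h0, sub_self]
    · intro k _ hk
      rw [ip_C_mul_left]
      rcases lt_trichotomy (k : ℕ) m with h | h | h
      · rw [← ip_conj (monicOP μ m), ih m hm k h]; simp
      · exact absurd (Fin.ext h) hk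
      · rw [ih k k.isLt m h, mul_zero]
    · simp

theorem ip_monicOP_of_degree_lt [IsFiniteMeasure μ] (hμ : ∀ p, ip μ p p = 0 → p = 0) (n : ℕ)
    (p : ℂ[X]) (hp : p.degree < n) : ip μ p (monicOP μ n) = 0 := by
  suffices H : ∀ m ≤ n, ∀ p : ℂ[X], p.degree < m → ip μ p (monicOP μ n) = 0 from
    H n le_rfl p hp
  intro m
  induction m with
  | zero =>
    intro _ p hp
    have : p = 0 := by simpa using hp
    rw [this]
    exact map_zero (ipLin μ _)
  | succ m ih =>
    intro hm p hp
    have hd : (p - C (p.coeff m) * monicOP μ m).degree < m := by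
      rw [degree_lt_iff_coeff_zero]
      intro k hk
      rcases hk.eq_or_lt with rfl | hk
      · simp [monicOP_coeff]
      · rw [coeff_sub, coeff_C_mul, coeff_eq_zero_of_degree_lt (p := monicOP μ m),
          coeff_eq_zero_of_degree_lt (p := p)]
        · simp
        · exact hp.trans_le (by exact_mod_cast hk)
        · rw [monicOP_degree]; exact_mod_cast hk
    have h := ih (by omega) _ hd
    rw [ip_sub_left, ip_C_mul_left, ← ip_conj (monicOP μ n) (monicOP μ m),
      ip_monicOP_of_lt hμ n m hm] at h
    simpa using h

theorem ip_self_eq (p : ℂ[X]) :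
    ip μ p p = (((2 * π)⁻¹ * ∫ θ, ‖p.eval (pt θ)‖ ^ 2 ∂μ : ℝ) : ℂ) := by
  unfold ip
  simp only [Complex.mul_conj, Complex.normSq_eq_norm_sq]
  rw [integral_complex_ofReal]
  push_cast
  rfl

theorem ip_self_re_pos (hμ : ∀ p, ip μ p p = 0 → p = 0) (n : ℕ) :
    0 < (ip μ (monicOP μ n) (monicOP μ n)).re := by
  have h0 : ip μ (monicOP μ n) (monicOP μ n) ≠ 0 := fun h => by
    have := monicOP_coeff (μ := μ) n
    simp [hμ _ h] at this
  rw [ip_self_eq] at h0 ⊢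
  rw [Complex.ofReal_re]
  refine lt_of_le_of_ne ?_ fun h => h0 (by rw [← h]; simp)
  have := Real.pi_pos
  have h2 : 0 ≤ ∫ θ, ‖(monicOP μ n).eval (pt θ)‖ ^ 2 ∂μ := integral_nonneg fun θ => by positivity
  positivity

theorem kappa_pos (hμ : ∀ p, ip μ p p = 0 → p = 0) (n : ℕ) : 0 < kappa μ n :=
  inv_pos.2 (Real.sqrt_pos.2 (ip_self_re_pos hμ n))

theorem ip_self_eq_kappa (hμ : ∀ p, ip μ p p = 0 → p = 0) (n : ℕ) :
    ip μ (monicOP μ n) (monicOP μ n) = ((kappa μ n : ℂ) ^ 2)⁻¹ := by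
  have h := ip_self_re_pos hμ n
  rw [kappa, ← Complex.ofReal_pow, inv_pow, Real.sq_sqrt h.le, ← Complex.ofReal_inv, inv_inv,
    ip_self_eq, Complex.ofReal_re]

/-- The polynomials `φ_n` are orthonormal (and `φ_n` has degree `n` and leading coefficient
`κ_n > 0`). -/
theorem ip_orthoPoly [IsFiniteMeasure μ] (hμ : ∀ p, ip μ p p = 0 → p = 0) (n m : ℕ) :
    ip μ (orthoPoly μ n) (orthoPoly μ m) = if n = m then 1 else 0 := by
  unfold orthoPoly
  rw [ip_C_mul_left, ← ip_conj, ip_C_mul_left]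
  split_ifs with h
  · subst h
    have hk : (kappa μ n : ℂ) ≠ 0 := by exact_mod_cast (kappa_pos hμ n).ne'
    rw [ip_self_eq_kappa hμ]
    simp only [map_mul, map_inv₀, map_pow, Complex.conj_ofReal]
    field_simp
  · rcases lt_or_gt_of_ne h with h | h
    · rw [ip_monicOP_of_lt hμ m n h]; simp
    · rw [← ip_conj, ip_monicOP_of_lt hμ n m h]; simp

theorem reversed_coeff (n : ℕ) (p : ℂ[X]) {k : ℕ} (hk : k ≤ n) :
    (reversed n p).coeff k = conj (p.coeff (n - k)) := by
  simp [reversed, coeff_reflect, revAt_le hk]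

theorem reversed_coeff_of_lt {n : ℕ} {p : ℂ[X]} (hp : p.natDegree ≤ n) {k : ℕ} (hk : n < k) :
    (reversed n p).coeff k = 0 := by
  rw [reversed, coeff_reflect, revAt_eq_self_of_lt hk, coeff_map,
    coeff_eq_zero_of_natDegree_lt (hp.trans_lt hk), map_zero]

/-- The reversed polynomial `Φ_n^*` is orthogonal to `z, …, z^n`. -/
theorem ip_X_mul_reversed [IsFiniteMeasure μ] (hμ : ∀ p, ip μ p p = 0 → p = 0) (n : ℕ) (q : ℂ[X])
    (hq : q.degree < n) : ip μ (X * q) (reversed n (monicOP μ n)) = 0 := by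
  have hdeg : (X * q).natDegree ≤ n := by
    rcases eq_or_ne q 0 with rfl | h
    · simp
    · rw [natDegree_X_mul h]
      exact (natDegree_lt_iff_degree_lt h).2 hq
  have hrr : reversed n (reversed n (X * q)) = X * q := by
    ext k
    rcases le_or_gt k n with hk | hk
    · rw [reversed_coeff _ _ hk, reversed_coeff _ _ (Nat.sub_le _ _), Nat.sub_sub_self hk,
        Complex.conj_conj]
    · rw [reversed_coeff_of_lt _ hk, coeff_eq_zero_of_natDegree_lt (hdeg.trans_lt hk)]
      rw [natDegree_le_iff_coeff_eq_zero]
      intro N hN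
      exact reversed_coeff_of_lt hdeg hN
  have hd : (reversed n (X * q)).degree < n := by
    rw [degree_lt_iff_coeff_zero]
    intro k hk
    rcases hk.eq_or_lt with rfl | hk
    · rw [reversed_coeff _ _ le_rfl]; simp
    · exact reversed_coeff_of_lt hdeg hk
  rw [← hrr, ip_reversed, ← ip_conj, ip_monicOP_of_degree_lt hμ n _ hd, map_zero]
  · rw [natDegree_le_iff_coeff_eq_zero]
    intro N hN
    exact reversed_coeff_of_lt hdeg hN
  · exact (monicOP_natDegree n).le

theorem monicOP_succ [IsFiniteMeasure μ] (hμ : ∀ p, ip μ p p = 0 → p = 0) (n : ℕ) :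
    monicOP μ (n + 1) =
      X * monicOP μ n - C (conj (verblunsky μ n)) * reversed n (monicOP μ n) := by
  set a := conj (verblunsky μ n) with ha
  set D := monicOP μ (n + 1) - X * monicOP μ n + C a * reversed n (monicOP μ n) with hD
  have hnd := (monicOP_natDegree (μ := μ) n).le
  have h0 : D.coeff 0 = 0 := by
    rw [hD, coeff_add, coeff_sub, coeff_C_mul, reversed_coeff _ _ (Nat.zero_le n), mul_coeff_zero,
      Nat.sub_zero, monicOP_coeff, ha, verblunsky, coeff_zero_eq_eval_zero]
    simp
  obtain ⟨q, hq⟩ := X_dvd_iff.2 h0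
  have hqd : q.degree < n := by
    rw [degree_lt_iff_coeff_zero]
    intro k hk
    have : q.coeff k = D.coeff (k + 1) := by rw [hq, coeff_X_mul]
    rw [this, hD, coeff_add, coeff_sub, coeff_C_mul, coeff_X_mul,
      reversed_coeff_of_lt hnd (by omega)]
    rcases hk.eq_or_lt with rfl | hk
    · simp [monicOP_coeff]
    · rw [coeff_eq_zero_of_natDegree_lt (p := monicOP μ n) (by rw [monicOP_natDegree]; omega),
        coeff_eq_zero_of_natDegree_lt (by rw [monicOP_natDegree]; omega)]
      simp
  have h1 : ip μ (monicOP μ (n + 1)) D = 0 := by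
    rw [← ip_conj, ip_monicOP_of_degree_lt hμ, map_zero]
    rw [hq, mul_comm, degree_mul_X]
    rcases eq_or_ne q 0 with rfl | h
    · simp
    · rw [degree_eq_natDegree h] at hqd ⊢
      norm_cast at hqd ⊢
      omega
  have h2 : ip μ (X * monicOP μ n) D = 0 := by
    rw [hq, ip_X_mul, ← ip_conj, ip_monicOP_of_degree_lt hμ n q hqd, map_zero]
  have h3 : ip μ (reversed n (monicOP μ n)) D = 0 := by
    rw [hq, ← ip_conj, ip_X_mul_reversed hμ n q hqd, map_zero]
  have hDD : ip μ D D = 0 := by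
    conv_lhs => rw [hD]
    rw [ip_add_left, ip_sub_left, ip_C_mul_left, h1, h2, h3]
    simp
  have := hμ D hDD
  rw [hD] at this
  linear_combination this

/-- `ρ_n^2 = 1 - |α_n|^2` for `ρ_n = κ_n / κ_{n+1}`; in particular `|α_n| < 1`. -/
theorem rho_sq [IsFiniteMeasure μ] (hμ : ∀ p, ip μ p p = 0 → p = 0) (n : ℕ) :
    (kappa μ n / kappa μ (n + 1)) ^ 2 = 1 - ‖verblunsky μ n‖ ^ 2 := by
  set a := conj (verblunsky μ n) with ha
  have hnd := (monicOP_natDegree (μ := μ) n).le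
  have hs : X * monicOP μ n = monicOP μ (n + 1) + C a * reversed n (monicOP μ n) := by
    rw [monicOP_succ hμ n]; ring
  have hr : (reversed n (monicOP μ n)).degree < (n + 1 : ℕ) := by
    rw [degree_lt_iff_coeff_zero]
    intro k hk
    exact reversed_coeff_of_lt hnd (by omega)
  have h1 : ip μ (reversed n (monicOP μ n)) (monicOP μ (n + 1)) = 0 :=
    ip_monicOP_of_degree_lt hμ _ _ hr
  have h2 : ip μ (monicOP μ (n + 1)) (reversed n (monicOP μ n)) = 0 := by
    rw [← ip_conj, h1, map_zero]
  have h3 := ip_X_mul (μ := μ) (monicOP μ n) (monicOP μ n)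
  rw [hs, ip_add_left, ip_C_mul_left, ← ip_conj _ (monicOP μ (n + 1)),
    ← ip_conj _ (reversed n (monicOP μ n)), ip_add_left, ip_add_left, ip_C_mul_left,
    ip_C_mul_left, h1, h2, ip_reversed hnd hnd, ip_self_eq_kappa hμ, ip_self_eq_kappa hμ] at h3
  have hk : (kappa μ n : ℂ) ≠ 0 := by exact_mod_cast (kappa_pos hμ n).ne'
  have hk' : (kappa μ (n + 1) : ℂ) ≠ 0 := by exact_mod_cast (kappa_pos hμ (n + 1)).ne'
  have hn : a * conj a = (‖verblunsky μ n‖ : ℂ) ^ 2 := by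
    rw [Complex.mul_conj, Complex.normSq_eq_norm_sq, ha, RCLike.norm_conj]
    push_cast
    rfl
  simp only [map_add, map_mul, map_inv₀, map_pow, map_zero, Complex.conj_ofReal] at h3
  have : ((kappa μ n : ℂ) / kappa μ (n + 1)) ^ 2 = 1 - (‖verblunsky μ n‖ : ℂ) ^ 2 := by
    rw [← hn]
    field_simp at h3 ⊢
    linear_combination h3
  exact_mod_cast this

/-- The recurrence `φ_{n+1} = ρ_n⁻¹ (z φ_n - conj α_n φ_n^*)`, `ρ_n = (1 - |α_n|^2)^{1/2}`. -/
theorem orthoPoly_succ [IsFiniteMeasure μ] (hμ : ∀ p, ip μ p p = 0 → p = 0) (n : ℕ) :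
    orthoPoly μ (n + 1) = C ((√(1 - ‖verblunsky μ n‖ ^ 2) : ℝ) : ℂ)⁻¹ *
      (X * orthoPoly μ n - C (conj (verblunsky μ n)) * reversed n (orthoPoly μ n)) := by
  have hk := kappa_pos hμ n
  have hk' := kappa_pos hμ (n + 1)
  have hrev : reversed n (orthoPoly μ n) = C (kappa μ n : ℂ) * reversed n (monicOP μ n) := by
    simp [reversed, orthoPoly, reflect_C_mul]
  rw [hrev, ← rho_sq hμ, Real.sqrt_sq (by positivity), orthoPoly, orthoPoly, monicOP_succ hμ n]
  have : (kappa μ (n + 1) : ℂ) =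
      (((kappa μ n / kappa μ (n + 1) : ℝ) : ℂ))⁻¹ * (kappa μ n : ℂ) := by
    have h1 : (kappa μ n : ℂ) ≠ 0 := by exact_mod_cast hk.ne'
    have h2 : (kappa μ (n + 1) : ℂ) ≠ 0 := by exact_mod_cast hk'.ne'
    push_cast
    field_simp
  rw [this, C_mul]
  ring

/-- The measure `w dθ` with `w > 0` satisfies the hypothesis of the facts above. -/
theorem weightMeasure_definite {w : AngleCircle → ℝ} (hw : Measurable w) (hpos : ∀ θ, 0 < w θ)
    [IsFiniteMeasure (weightMeasure w)] (p : ℂ[X]) (hp : ip (weightMeasure w) p p = 0) :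
    p = 0 := by
  rw [ip_self_eq] at hp
  have hpi := Real.pi_pos.ne'
  have h0 : ∫ θ, ‖p.eval (pt θ)‖ ^ 2 ∂(weightMeasure w) = 0 := by
    have := Complex.ofReal_eq_zero.1 hp
    simpa [hpi] using this
  have hc : Continuous fun θ => ‖p.eval (pt θ)‖ ^ 2 :=
    ((p.continuous.comp continuous_pt).norm.pow 2)
  rw [integral_eq_zero_iff_of_nonneg (fun θ => by positivity)
    (hc.integrable_of_hasCompactSupport (HasCompactSupport.of_compactSpace _))] at h0
  have hac : (volume : Measure AngleCircle) ≪ weightMeasure w :=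
    withDensity_absolutelyContinuous' (hw.ennreal_ofReal.aemeasurable)
      (Eventually.of_forall fun θ => by simpa using hpos θ)
  have h1 := Measure.eq_of_ae_eq (hac.ae_le h0) hc continuous_const
  refine eq_zero_of_infinite_isRoot p (Set.Infinite.mono (s := Set.range pt) ?_ ?_)
  · rintro _ ⟨θ, rfl⟩
    simpa [IsRoot] using congrFun h1 θ
  · have hinj : Function.Injective pt :=
      Subtype.val_injective.comp (AddCircle.injective_toCircle Real.two_pi_pos.ne')
    have : Infinite AngleCircle := by
      rw [(AddCircle.equivIco (2 * π) 0).infinite_iff]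
      exact (Set.Ico_infinite (by linarith [Real.two_pi_pos])).to_subtype
    exact Set.infinite_range_of_injective hinj

end Recurrence

end

end OPUC

/-! Since `w` is positive, `log w` lies in the Wiener algebra. Splitting it by frequency and
exponentiating gives `w = D * star D`, where `D` and `F = D⁻¹` have only nonnegative frequencies.
The limits turn out to be `f_+ = F` and `f_- = star F`, so `S = star F * D`.

Baxter's part. By orthogonality `w Φ_n^*` has no frequencies `1, …, n`. Divide its low part by `star
D` and its high part by `D`, and call the quotients `G_n` and `H_n`. Comparing supports, each of
`H_n` and `G_n - G_n(0)` is at most the other quotient times the tail of `S` below `-n`, where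
`G_n(0)` is the zeroth coefficient. Hence `H_n → 0`, `G_n` tends to a constant, and `Φ_n^*`
converges in norm to a multiple of `F`. The recurrence gives `H_{n+1} = H_n - α_n z^{n+1} star G_n`,
and the support of `H_{n+1}` forces the coefficient of `H_n` at `n + 1` to cancel. So `‖H_n‖`
eventually drops by at least a fixed multiple of `|α_n|` at each step, and `α` is summable
(`summable_norm`).

Weighted part. Let `(A, B)` be the limiting first row of the transfer matrices starting from `N`.
Inverting the product by its adjugate shows that `B` and `star A * S` agree below `-N`. When the
weighted tail of `α` beyond `N` is small, `A` is close to `1` and `B` is close to its linear part,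
whose coefficients are the `-conj α_i`. So the tails of `α` and of `S` bound each other up to a
factor `4` (`wnorm_tail_comparison`). That argument absorbs terms into the left side, so it needs
finite norms. It is therefore run for the weights `min ν 2^j`, which are again submultiplicative,
with `N` independent of `j`. In the direction from `S` to `α`, smallness of the tail passes from `j`
to `j + 1` because doubling the height at most doubles the weight. Only the Wiener algebra is ever
inverted or factorized, so no growth condition on `ν` enters. -/

open scoped ENNReal

namespace OPUC

noncomputable section

open AddCircle (haarAddCircle)

/-! ### Fourier coefficients and weighted sums -/

/-- The `n`-th Fourier coefficient, as a continuous linear functional. -/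
def coeffCLM (n : ℤ) : C(AngleCircle, ℂ) →L[ℂ] ℂ :=
  LinearMap.mkContinuous
    { toFun := fun f => fourierCoeff f n
      map_add' := fun f g => by
        have hf := f.continuous.integrable_of_hasCompactSupport (μ := haarAddCircle (T := 2 * π))
          (HasCompactSupport.of_compactSpace _)
        have hg := g.continuous.integrable_of_hasCompactSupport (μ := haarAddCircle (T := 2 * π))
          (HasCompactSupport.of_compactSpace _)
        exact congrFun (fourierCoeff.add hf hg) n
      map_smul' := fun c f => fourierCoeff.const_smul f c n } 1 (fun f => by
    have h : ∀ θ, ‖fourier (-n) θ • f θ‖ ≤ ‖f‖ := fun θ => by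
      rw [norm_smul, fourier_apply, Circle.norm_coe, one_mul]
      exact f.norm_coe_le_norm θ
    have := norm_integral_le_of_norm_le_const (μ := haarAddCircle (T := 2 * π))
      (Eventually.of_forall h)
    simpa [fourierCoeff, one_mul] using this)

theorem coeffCLM_apply (n : ℤ) (f : C(AngleCircle, ℂ)) : coeffCLM n f = fourierCoeff f n := rfl

theorem fourier_eq_pt_zpow (k : ℤ) (θ : AngleCircle) : fourier k θ = pt θ ^ k := by
  rw [fourier_apply, AddCircle.toCircle_zsmul, pt, Circle.coe_zpow]

theorem fourierCoeff_fourier_mul (k n : ℤ) (g : C(AngleCircle, ℂ)) :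
    fourierCoeff (fourier k * g : C(AngleCircle, ℂ)) n = fourierCoeff g (n - k) := by
  unfold fourierCoeff
  congr 1
  funext θ
  simp only [ContinuousMap.mul_apply, smul_eq_mul, ← mul_assoc]
  rw [← fourier_add]
  congr 3
  ring

/-- Summability of one factor suffices: its Fourier series converges uniformly, and may be
multiplied by `g` before the continuous functional `coeffCLM n` is applied term by term. -/
theorem hasSum_fourierCoeff_mul {f : C(AngleCircle, ℂ)} (hf : Summable (fourierCoeff f))
    (g : C(AngleCircle, ℂ)) (n : ℤ) :
    HasSum (fun k => fourierCoeff f k * fourierCoeff g (n - k))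
      (fourierCoeff (f * g : C(AngleCircle, ℂ)) n) := by
  have h := ((hasSum_fourier_series_of_summable hf).mul_right g).mapL (coeffCLM n)
  refine h.congr_fun fun k => ?_
  simp only [smul_mul_assoc, map_smul, coeffCLM_apply, fourierCoeff_fourier_mul, smul_eq_mul]

theorem fourierCoeff_star (f : C(AngleCircle, ℂ)) (n : ℤ) :
    fourierCoeff (star f : C(AngleCircle, ℂ)) n = conj (fourierCoeff f (-n)) := by
  unfold fourierCoeff
  rw [← integral_conj]
  congr 1
  funext θ
  simp only [smul_eq_mul, map_mul, neg_neg, fourier_neg, ContinuousMap.star_apply]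
  rfl

/-- The weighted sum `∑ ν k |a k|`, with values in `[0, ∞]`. -/
def wsum (ν : ℤ → ℝ≥0∞) (a : ℤ → ℂ) : ℝ≥0∞ := ∑' k, ν k * ‖a k‖ₑ

/-- Values in `[0, ∞]` allow interchanging the sums with no summability hypothesis. The case `ν = 1`
makes the Wiener algebra a normed algebra; the truncated weights use the general case. -/
theorem wsum_conv_le {ν : ℤ → ℝ≥0∞} (hν : ∀ m n, ν (m + n) ≤ ν m * ν n) {a b c : ℤ → ℂ}
    (h : ∀ n, HasSum (fun k => a k * b (n - k)) (c n)) : wsum ν c ≤ wsum ν a * wsum ν b := by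
  calc wsum ν c ≤ ∑' n, ∑' k, (ν k * ‖a k‖ₑ) * (ν (n - k) * ‖b (n - k)‖ₑ) := by
        refine ENNReal.tsum_le_tsum fun n => ?_
        rw [← (h n).tsum_eq]
        calc ν n * ‖∑' k, a k * b (n - k)‖ₑ
            ≤ ν n * ∑' k, ‖a k * b (n - k)‖ₑ := by gcongr; exact enorm_tsum_le_tsum_enorm
          _ = ∑' k, ν n * ‖a k * b (n - k)‖ₑ := ENNReal.tsum_mul_left.symm
          _ ≤ _ := by
            refine ENNReal.tsum_le_tsum fun k => ?_
            have : ν n ≤ ν k * ν (n - k) := by simpa using hν k (n - k)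
            calc ν n * ‖a k * b (n - k)‖ₑ ≤ (ν k * ν (n - k)) * ‖a k * b (n - k)‖ₑ := by gcongr
              _ = _ := by rw [enorm_mul]; ring
    _ = ∑' k, ∑' n, (ν k * ‖a k‖ₑ) * (ν (n - k) * ‖b (n - k)‖ₑ) := ENNReal.tsum_comm
    _ = ∑' k, (ν k * ‖a k‖ₑ) * wsum ν b := by
        refine tsum_congr fun k => ?_
        rw [ENNReal.tsum_mul_left, wsum]
        congr 1
        exact (Equiv.subRight k).tsum_eq (fun n => ν n * ‖b n‖ₑ)
    _ = _ := ENNReal.tsum_mul_right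

theorem summable_iff_wsum_one {a : ℤ → ℂ} : Summable a ↔ wsum 1 a ≠ ∞ := by
  have h := ENNReal.tsum_coe_ne_top_iff_summable_coe (f := fun k => ‖a k‖₊)
  simp only [coe_nnnorm] at h
  rw [← summable_norm_iff, ← h]
  simp [wsum, enorm]

/-! ### The Wiener algebra -/

/-- The Wiener algebra, as a subalgebra of the continuous functions on the circle. -/
def wienerSubalgebra : StarSubalgebra ℂ C(AngleCircle, ℂ) where
  carrier := {f | Summable (fourierCoeff f)}
  mul_mem' {f g} hf hg := by
    rw [Set.mem_ofPred_eq, summable_iff_wsum_one] at hg ⊢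
    refine ne_top_of_le_ne_top (ENNReal.mul_ne_top (summable_iff_wsum_one.1 hf) hg)
      (wsum_conv_le (by simp) fun n => hasSum_fourierCoeff_mul hf g n)
  add_mem' {f g} hf hg := by
    have : fourierCoeff (f + g : C(AngleCircle, ℂ)) = fourierCoeff f + fourierCoeff g :=
      funext fun n => map_add (coeffCLM n) f g
    rw [Set.mem_ofPred_eq, this]
    exact Summable.add hf hg
  algebraMap_mem' c := by
    refine summable_of_ne_finset_zero (s := {0}) fun n hn => ?_
    have h : algebraMap ℂ C(AngleCircle, ℂ) c = c • fourier 0 := by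
      ext θ; simp [Algebra.algebraMap_eq_smul_one]
    rw [h, ← coeffCLM_apply, map_smul, coeffCLM_apply, fourierCoeff_fourier]
    simp [Finset.notMem_singleton.1 hn]
  star_mem' {f} hf := by
    rw [Set.mem_ofPred_eq] at hf ⊢
    have : fourierCoeff (star f : C(AngleCircle, ℂ)) = fun n => conj (fourierCoeff f (-n)) :=
      funext (fourierCoeff_star f)
    rw [this, ← summable_norm_iff]
    simpa [Function.comp_def] using (Equiv.neg ℤ).summable_iff.2 hf.norm

/-- The Wiener algebra, which carries the `ℓ¹` norm of the Fourier coefficients. -/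
def Wiener : Type := wienerSubalgebra

namespace Wiener

instance : CommRing Wiener := inferInstanceAs (CommRing wienerSubalgebra)
instance : StarRing Wiener := inferInstanceAs (StarRing wienerSubalgebra)
instance : Algebra ℂ Wiener := inferInstanceAs (Algebra ℂ wienerSubalgebra)
instance : StarModule ℂ Wiener := inferInstanceAs (StarModule ℂ wienerSubalgebra)

/-- The inclusion of the Wiener algebra into the continuous functions. -/
def ev : Wiener →⋆ₐ[ℂ] C(AngleCircle, ℂ) := wienerSubalgebra.subtype

theorem ev_injective : Function.Injective ev := Subtype.val_injective

theorem ext_ev {f g : Wiener} (h : ∀ θ, ev f θ = ev g θ) : f = g :=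
  ev_injective (ContinuousMap.ext h)

/-- The Fourier coefficients of an element of the Wiener algebra. -/
def coeff (k : ℤ) : Wiener →ₗ[ℂ] ℂ := (coeffCLM k : C(AngleCircle, ℂ) →ₗ[ℂ] ℂ) ∘ₗ ev.toLinearMap

theorem fourierCoeff_ev (f : Wiener) (k : ℤ) : fourierCoeff (ev f) k = coeff k f := rfl

theorem summable_coeff (f : Wiener) : Summable fun k => coeff k f := f.2

theorem summable_norm_coeff (f : Wiener) : Summable fun k => ‖coeff k f‖ := f.summable_coeff.norm

theorem hasSum_ev (f : Wiener) : HasSum (fun k => coeff k f • fourier k) (ev f) :=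
  hasSum_fourier_series_of_summable (f := ev f) f.summable_coeff

theorem hasSum_eval (f : Wiener) (θ : AngleCircle) :
    HasSum (fun k => coeff k f * pt θ ^ k) (ev f θ) := by
  have h := (ContinuousMap.evalCLM ℂ θ).hasSum f.hasSum_ev
  refine h.congr_fun fun k => ?_
  simp [← fourier_eq_pt_zpow]

theorem ext_coeff {f g : Wiener} (h : ∀ k, coeff k f = coeff k g) : f = g := by
  refine ev_injective (f.hasSum_ev.unique ?_)
  simpa only [h] using g.hasSum_ev

theorem hasSum_coeff_mul (f g : Wiener) (n : ℤ) :
    HasSum (fun k => coeff k f * coeff (n - k) g) (coeff n (f * g)) :=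
  hasSum_fourierCoeff_mul (f := ev f) f.2 (ev g) n

theorem coeff_star (f : Wiener) (n : ℤ) : coeff n (star f) = conj (coeff (-n) f) :=
  fourierCoeff_star (ev f) n

/-- The weighted norm of an element of the Wiener algebra. -/
def wnorm (ν : ℤ → ℝ≥0∞) (f : Wiener) : ℝ≥0∞ := wsum ν fun k => coeff k f

theorem wnorm_mul_le {ν : ℤ → ℝ≥0∞} (hν : ∀ m n, ν (m + n) ≤ ν m * ν n) (f g : Wiener) :
    wnorm ν (f * g) ≤ wnorm ν f * wnorm ν g := wsum_conv_le hν (hasSum_coeff_mul f g)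

instance : Norm Wiener := ⟨fun f => ∑' k, ‖coeff k f‖⟩

theorem norm_def (f : Wiener) : ‖f‖ = ∑' k, ‖coeff k f‖ := rfl

theorem ofReal_norm_eq (f : Wiener) : ENNReal.ofReal ‖f‖ = wnorm 1 f := by
  rw [norm_def, ENNReal.ofReal_tsum_of_nonneg (fun _ => norm_nonneg _) f.summable_norm_coeff]
  simp [wnorm, wsum]

instance : NormedAddCommGroup Wiener :=
  AddGroupNorm.toNormedAddCommGroup
    { toFun := fun f => ‖f‖
      map_zero' := by simp [norm_def]
      add_le' := fun f g => by
        simp only [norm_def]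
        rw [← f.summable_norm_coeff.tsum_add g.summable_norm_coeff]
        refine (f + g).summable_norm_coeff.tsum_le_tsum (fun k => ?_)
          (f.summable_norm_coeff.add g.summable_norm_coeff)
        rw [map_add]
        exact norm_add_le _ _
      neg' := fun f => by simp [norm_def]
      eq_zero_of_map_eq_zero' := fun f hf => by
        refine ext_coeff fun k => ?_
        have h := (hasSum_zero_iff_of_nonneg (fun k => norm_nonneg (coeff k f))).1
          ((show ∑' k, ‖coeff k f‖ = 0 from hf) ▸ f.summable_norm_coeff.hasSum)
        simpa using congrFun h k }

instance : NormedCommRing Wiener where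
  dist_eq := NormedAddGroup.dist_eq
  norm_mul_le f g := by
    have h := wnorm_mul_le (ν := 1) (by simp) f g
    simp only [← ofReal_norm_eq] at h
    rwa [← ENNReal.ofReal_mul (norm_nonneg _), ENNReal.ofReal_le_ofReal_iff (by positivity)] at h

instance : NormedAlgebra ℂ Wiener where
  norm_smul_le c f := by
    simp only [norm_def, map_smul, norm_smul]
    rw [tsum_mul_left]

theorem norm_coeff_le (k : ℤ) (f : Wiener) : ‖coeff k f‖ ≤ ‖f‖ :=
  f.summable_norm_coeff.le_tsum k fun _ _ => norm_nonneg _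

theorem norm_ev_le (f : Wiener) : ‖ev f‖ ≤ ‖f‖ := by
  rw [← f.hasSum_ev.tsum_eq, norm_def]
  refine tsum_of_norm_bounded f.summable_norm_coeff.hasSum fun k => ?_
  rw [norm_smul, fourier_norm, mul_one]

theorem continuous_ev : Continuous ev :=
  (LinearMap.mkContinuous (ev : Wiener →ₗ[ℂ] C(AngleCircle, ℂ)) 1
    fun f => by simpa using norm_ev_le f).continuous

theorem continuous_coeff (k : ℤ) : Continuous (coeff k) :=
  (LinearMap.mkContinuous (coeff k) 1 fun f => by simpa using norm_coeff_le k f).continuous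

/-- Every summable sequence is the sequence of Fourier coefficients of an element of the Wiener
algebra. -/
theorem exists_coeff_eq {a : ℤ → ℂ} (ha : Summable a) : ∃ f : Wiener, ∀ k, coeff k f = a k := by
  have hs : Summable fun k => a k • (fourier k : C(AngleCircle, ℂ)) :=
    .of_norm <| by simpa [norm_smul, fourier_norm] using ha.norm
  obtain ⟨f, hf⟩ := hs
  have hc : ∀ n, fourierCoeff f n = a n := fun n => by
    have h := hf.mapL (coeffCLM n)
    have h2 := hasSum_single (f := fun k => coeffCLM n (a k • fourier k)) n fun k hk => by
      rw [map_smul, coeffCLM_apply, fourierCoeff_fourier]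
      simp [hk.symm]
    have := h.unique h2
    rw [map_smul, coeffCLM_apply, coeffCLM_apply, fourierCoeff_fourier] at this
    simpa using this
  exact ⟨⟨f, show Summable (fourierCoeff f) by rwa [funext hc]⟩, hc⟩

instance : CompleteSpace Wiener := by
  let Φ : Wiener →ₗᵢ[ℂ] lp (fun _ : ℤ => ℂ) 1 :=
    { toFun := fun f => ⟨fun k => coeff k f, memℓp_gen (by simpa using f.summable_norm_coeff)⟩
      map_add' := fun f g => by ext k; exact map_add (coeff k) f g
      map_smul' := fun c f => by ext k; simp
      norm_map' := fun f => by
        change ‖(⟨fun k => coeff k f, _⟩ : lp (fun _ : ℤ => ℂ) 1)‖ = _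
        rw [lp.norm_eq_tsum_rpow (by simp)]
        simp [norm_def] }
  have hΦ : Function.Surjective Φ := fun a => by
    have ha : Summable fun k => a k := by
      have := lp.memℓp a
      rw [memℓp_gen_iff (by simp)] at this
      exact .of_norm (by simpa using this)
    obtain ⟨f, hf⟩ := exists_coeff_eq ha
    exact ⟨f, by ext k; exact hf k⟩
  exact (LinearIsometryEquiv.ofSurjective Φ hΦ).toIsometryEquiv.completeSpace

/-! ### Monomials, projections and supports -/

/-- The monomial `z ^ k` in the Wiener algebra. -/
def mono (k : ℤ) : Wiener :=
  ⟨fourier k, show Summable (fourierCoeff (fourier k)) by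
    refine summable_of_ne_finset_zero (s := {k}) fun n hn => ?_
    rw [fourierCoeff_fourier]
    simp [Finset.notMem_singleton.1 hn]⟩

theorem ev_mono (k : ℤ) (θ : AngleCircle) : ev (mono k) θ = pt θ ^ k := fourier_eq_pt_zpow k θ

theorem coeff_mono (k n : ℤ) : coeff n (mono k) = if n = k then 1 else 0 := by
  rw [← fourierCoeff_ev]
  change fourierCoeff (fourier k) n = _
  rw [fourierCoeff_fourier, Pi.single_apply]

theorem coeff_mono_mul (k n : ℤ) (f : Wiener) : coeff n (mono k * f) = coeff (n - k) f :=
  fourierCoeff_fourier_mul k n (ev f)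

theorem mono_add (j k : ℤ) : mono (j + k) = mono j * mono k :=
  ext_ev fun θ => by simp [ev_mono, zpow_add₀ (pt_ne_zero θ)]

theorem mono_zero : mono 0 = 1 := ext_ev fun θ => by simp [ev_mono]

theorem mono_neg_mul (k : ℤ) : mono (-k) * mono k = 1 := by rw [← mono_add]; simp [mono_zero]

theorem mono_pow (k : ℤ) (n : ℕ) : mono k ^ n = mono (k * n) :=
  ext_ev fun θ => by simp [ev_mono, zpow_mul]

theorem star_mono (k : ℤ) : star (mono k) = mono (-k) :=
  ext_coeff fun n => by
    rw [coeff_star, coeff_mono, coeff_mono]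
    by_cases h : n = -k
    · simp [h]
    · rw [if_neg h, if_neg (by omega), map_zero]

theorem coeff_one (n : ℤ) : coeff n (1 : Wiener) = if n = 0 then 1 else 0 := by
  rw [← mono_zero, coeff_mono]

theorem coeff_smul_one (c : ℂ) (n : ℤ) : coeff n (c • (1 : Wiener)) = if n = 0 then c else 0 := by
  rw [map_smul, coeff_one, smul_eq_mul, mul_ite, mul_one, mul_zero]

theorem norm_mono_mul (k : ℤ) (f : Wiener) : ‖mono k * f‖ = ‖f‖ := by
  simp only [norm_def, coeff_mono_mul]
  exact (Equiv.subRight k).tsum_eq fun n => ‖coeff n f‖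

theorem norm_mono (k : ℤ) : ‖mono k‖ = 1 := by
  rw [norm_def, tsum_eq_single k fun n hn => by simp [coeff_mono, hn]]
  simp [coeff_mono]

instance : NormOneClass Wiener := ⟨by rw [← mono_zero, norm_mono]⟩

instance : Nontrivial Wiener := NormOneClass.nontrivial (G := Wiener)

theorem norm_star (f : Wiener) : ‖star f‖ = ‖f‖ := by
  simp only [norm_def, coeff_star, RCLike.norm_conj]
  exact (Equiv.neg ℤ).tsum_eq fun n => ‖coeff n f‖

theorem ev_star (f : Wiener) (θ : AngleCircle) : ev (star f) θ = conj (ev f θ) := by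
  rw [map_star]; rfl

/-- The projection onto the frequencies in `s`. -/
def proj (s : Set ℤ) (f : Wiener) : Wiener :=
  (exists_coeff_eq (f.summable_coeff.indicator s)).choose

open Classical in
theorem coeff_proj (s : Set ℤ) (f : Wiener) (k : ℤ) :
    coeff k (proj s f) = if k ∈ s then coeff k f else 0 := by
  rw [proj, (exists_coeff_eq (f.summable_coeff.indicator s)).choose_spec, Set.indicator_apply]

theorem coeff_proj_of_mem {s : Set ℤ} (f : Wiener) {k : ℤ} (hk : k ∈ s) :
    coeff k (proj s f) = coeff k f := by rw [coeff_proj, if_pos hk]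

theorem coeff_proj_of_notMem {s : Set ℤ} (f : Wiener) {k : ℤ} (hk : k ∉ s) :
    coeff k (proj s f) = 0 := by rw [coeff_proj, if_neg hk]

theorem norm_le_of_coeff {f g : Wiener} (h : ∀ k, ‖coeff k f‖ ≤ ‖coeff k g‖) : ‖f‖ ≤ ‖g‖ :=
  f.summable_norm_coeff.tsum_le_tsum h g.summable_norm_coeff

/-- The frequencies of `f` are at least `m`. -/
def SuppGE (m : ℤ) (f : Wiener) : Prop := ∀ k < m, coeff k f = 0

/-- The frequencies of `f` are at most `m`. -/
def SuppLE (m : ℤ) (f : Wiener) : Prop := ∀ k > m, coeff k f = 0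

theorem SuppGE.mono_le {m n : ℤ} {f : Wiener} (hf : SuppGE m f) (h : n ≤ m) : SuppGE n f :=
  fun k hk => hf k (by omega)

theorem SuppLE.mono_le {m n : ℤ} {f : Wiener} (hf : SuppLE m f) (h : m ≤ n) : SuppLE n f :=
  fun k hk => hf k (by omega)

theorem SuppGE.mul {m n : ℤ} {f g : Wiener} (hf : SuppGE m f) (hg : SuppGE n g) :
    SuppGE (m + n) (f * g) := fun k hk => by
  refine (hasSum_coeff_mul f g k).unique (hasSum_zero.congr_fun fun j => ?_)
  rcases lt_or_ge j m with h | h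
  · rw [hf j h, zero_mul]
  · rw [hg (k - j) (by omega), mul_zero]

theorem SuppLE.star {m : ℤ} {f : Wiener} (hf : SuppLE m f) : SuppGE (-m) (star f) := fun k hk => by
  rw [coeff_star, hf _ (by omega), map_zero]

theorem SuppGE.star {m : ℤ} {f : Wiener} (hf : SuppGE m f) : SuppLE (-m) (star f) := fun k hk => by
  rw [coeff_star, hf _ (by omega), map_zero]

theorem SuppLE.mul {m n : ℤ} {f g : Wiener} (hf : SuppLE m f) (hg : SuppLE n g) :
    SuppLE (m + n) (f * g) := by
  have h := (hf.star.mul hg.star).star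
  rw [star_mul', star_star, star_star] at h
  exact h.mono_le (by omega)

theorem SuppGE.add {m : ℤ} {f g : Wiener} (hf : SuppGE m f) (hg : SuppGE m g) :
    SuppGE m (f + g) := fun k hk => by rw [map_add, hf k hk, hg k hk, add_zero]

theorem SuppLE.add {m : ℤ} {f g : Wiener} (hf : SuppLE m f) (hg : SuppLE m g) :
    SuppLE m (f + g) := fun k hk => by rw [map_add, hf k hk, hg k hk, add_zero]

theorem SuppGE.smul {m : ℤ} {f : Wiener} (hf : SuppGE m f) (c : ℂ) : SuppGE m (c • f) :=
  fun k hk => by rw [map_smul, hf k hk, smul_zero]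

theorem SuppLE.smul {m : ℤ} {f : Wiener} (hf : SuppLE m f) (c : ℂ) : SuppLE m (c • f) :=
  fun k hk => by rw [map_smul, hf k hk, smul_zero]

theorem suppGE_mono (k : ℤ) : SuppGE k (mono k) := fun n hn => by
  rw [coeff_mono, if_neg (by omega)]

theorem suppLE_mono (k : ℤ) : SuppLE k (mono k) := fun n hn => by
  rw [coeff_mono, if_neg (by omega)]

theorem suppGE_one : SuppGE 0 (1 : Wiener) := mono_zero ▸ suppGE_mono 0

theorem suppLE_one : SuppLE 0 (1 : Wiener) := mono_zero ▸ suppLE_mono 0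

/-- At the lowest possible frequency the convolution has a single term. For `m = n = 0` this makes
the mean multiplicative on elements of nonnegative frequencies, which is how the means of `D` and
`F` are computed. -/
theorem SuppGE.coeff_mul {m n : ℤ} {f g : Wiener} (hf : SuppGE m f) (hg : SuppGE n g) :
    coeff (m + n) (f * g) = coeff m f * coeff n g := by
  refine (hasSum_coeff_mul f g (m + n)).unique ?_
  have := hasSum_single (f := fun k => coeff k f * coeff (m + n - k) g) m fun k hk => by
    rcases lt_or_gt_of_ne hk with h | h
    · rw [hf k h, zero_mul]
    · rw [hg _ (by omega), mul_zero]
  simpa using this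

theorem SuppGE.of_tendsto {m : ℤ} {F : ℕ → Wiener} {f : Wiener} (hF : ∀ n, SuppGE m (F n))
    (h : Tendsto F atTop (𝓝 f)) : SuppGE m f := fun k hk => by
  have h1 := ((continuous_coeff k).tendsto f).comp h
  refine tendsto_nhds_unique h1 ?_
  simp [Function.comp_def, hF _ k hk]

theorem SuppLE.of_tendsto {m : ℤ} {F : ℕ → Wiener} {f : Wiener} (hF : ∀ n, SuppLE m (F n))
    (h : Tendsto F atTop (𝓝 f)) : SuppLE m f := fun k hk => by
  have h1 := ((continuous_coeff k).tendsto f).comp h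
  refine tendsto_nhds_unique h1 ?_
  simp [Function.comp_def, hF _ k hk]

/-! ### Characters, the logarithm and the Wiener-Hopf factorization -/

theorem hasSum_mono (f : Wiener) : HasSum (fun k => coeff k f • mono k) f := by
  have hs : Summable fun k => coeff k f • mono k :=
    .of_norm <| by simpa [norm_smul, norm_mono] using f.summable_norm_coeff
  convert hs.hasSum
  refine ext_coeff fun n => ?_
  have h := (LinearMap.mkContinuous (coeff n) 1 fun f => by simpa using norm_coeff_le n f).hasSum
    hs.hasSum
  refine HasSum.unique ?_ h
  have := hasSum_single (f := fun k => coeff n (coeff k f • mono k)) n fun k hk => by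
    rw [map_smul, coeff_mono, if_neg hk.symm, smul_zero]
  rw [map_smul, coeff_mono, if_pos rfl, smul_eq_mul, mul_one] at this
  exact this

theorem pt_surjective {z : ℂ} (hz : ‖z‖ = 1) : ∃ θ, pt θ = z := by
  obtain ⟨θ, hθ⟩ := (AddCircle.homeomorphCircle Real.two_pi_pos.ne').surjective
    ⟨z, by simp [Submonoid.unitSphere, hz]⟩
  rw [AddCircle.homeomorphCircle_apply] at hθ
  exact ⟨θ, by rw [pt, hθ]⟩

/-- The characters of the Wiener algebra are the evaluations at the points of the circle. -/
theorem exists_character_eq_ev (φ : WeakDual.characterSpace ℂ Wiener) :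
    ∃ θ, ∀ f, φ f = ev f θ := by
  have hle : ∀ k, ‖φ (mono k)‖ ≤ 1 := fun k => by
    simpa [norm_mono] using AlgHom.norm_apply_le_self (𝕜 := ℂ) φ (mono k)
  have hmul : ∀ k, φ (mono (-k)) * φ (mono k) = 1 := fun k => by
    rw [← map_mul, mono_neg_mul, map_one]
  -- Both `z` and `z⁻¹` have norm one, so their images have modulus at most `1`, while the product
  -- of the images is `1`.
  have hz : ‖φ (mono 1)‖ = 1 := by
    refine le_antisymm (hle 1) ?_
    have h := congrArg norm (hmul 1)
    rw [norm_mul, norm_one] at h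
    nlinarith [hle (-1), norm_nonneg (φ (mono 1)), norm_nonneg (φ (mono (-1)))]
  obtain ⟨θ, hθ⟩ := pt_surjective hz
  have hk : ∀ k : ℤ, φ (mono k) = pt θ ^ k := by
    have hnat : ∀ n : ℕ, φ (mono n) = pt θ ^ n := fun n => by
      rw [hθ, ← map_pow, mono_pow, one_mul]
    intro k
    obtain ⟨n, rfl | rfl⟩ := k.eq_nat_or_neg
    · rw [hnat, zpow_natCast]
    · have := hmul n
      rw [hnat] at this
      rw [zpow_neg, zpow_natCast]
      exact eq_inv_of_mul_eq_one_left this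
  refine ⟨θ, fun f => ?_⟩
  have h := f.hasSum_mono.map φ (map_continuous φ)
  refine h.unique ((f.hasSum_eval θ).congr_fun fun k => ?_)
  rw [Function.comp_apply, map_smul, hk, smul_eq_mul]

/-- By Gelfand theory the spectrum of `x` consists of values of `x` on the circle, so the spectral
radius is below `1` and the spectral radius formula gives geometric decay. -/
theorem summable_norm_pow {x : Wiener} (hx : ∀ θ, ‖ev x θ‖ < 1) : Summable fun n => ‖x ^ n‖ := by
  have h1 : spectralRadius ℂ x < (1 : NNReal) := by
    refine spectrum.spectralRadius_lt_of_forall_lt x fun z hz => ?_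
    obtain ⟨φ, rfl⟩ := WeakDual.CharacterSpace.mem_spectrum_iff_exists.1 hz
    obtain ⟨θ, hθ⟩ := exists_character_eq_ev φ
    rw [hθ]
    exact_mod_cast hx θ
  obtain ⟨r, hr1, hr2⟩ := ENNReal.lt_iff_exists_nnreal_btwn.1 h1
  have h2 := (spectrum.pow_nnnorm_pow_one_div_tendsto_nhds_spectralRadius x).eventually_lt_const hr1
  have hr : (r : ℝ) < 1 := by exact_mod_cast hr2
  refine Summable.of_norm_bounded_eventually_nat (summable_geometric_of_lt_one r.2 hr) ?_
  filter_upwards [h2, eventually_gt_atTop 0] with n hn hpos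
  rw [norm_norm]
  have hn' : (0 : ℝ) < n := by exact_mod_cast hpos
  have h3 := ENNReal.rpow_le_rpow hn.le hn'.le
  rw [← ENNReal.rpow_mul, one_div_mul_cancel hn'.ne', ENNReal.rpow_one, ENNReal.rpow_natCast] at h3
  exact_mod_cast h3

theorem continuous_ev_apply (θ : AngleCircle) : Continuous fun f => ev f θ :=
  (ContinuousMap.evalCLM ℂ θ).continuous.comp continuous_ev

theorem ev_hasSum {F : ℕ → Wiener} {f : Wiener} (h : HasSum F f) (θ : AngleCircle) :
    HasSum (fun n => ev (F n) θ) (ev f θ) :=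
  h.map ({ toFun := fun f => ev f θ, map_zero' := by simp, map_add' := by simp } : Wiener →+ ℂ)
    (continuous_ev_apply θ)

/-- The logarithm of a positive function in the Wiener algebra is in the Wiener algebra. -/
theorem exists_log {f : Wiener} {g : AngleCircle → ℝ} (hg : ∀ θ, 0 < g θ)
    (hf : ∀ θ, ev f θ = g θ) : ∃ L : Wiener, ∀ θ, ev L θ = (Real.log (g θ) : ℂ) := by
  -- Any `c` above the supremum of `g` would do: then `g / c` lies in `(0, 1)` and `1 - f / c` takes
  -- values in the open unit disc.
  set c : ℝ := ‖f‖ + 1 with hc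
  have hc0 : 0 < c := by positivity
  have hgc : ∀ θ, g θ < c := fun θ => by
    have h := ((ev f).norm_coe_le_norm θ).trans f.norm_ev_le
    rw [hf, Complex.norm_real, Real.norm_of_nonneg (hg θ).le] at h
    linarith
  set x : Wiener := 1 - (c⁻¹ : ℂ) • f with hx
  have hev : ∀ θ, ev x θ = ((1 - g θ / c : ℝ) : ℂ) := fun θ => by
    rw [hx, map_sub, map_one, map_smul, ContinuousMap.sub_apply, ContinuousMap.smul_apply, hf]
    push_cast
    simp [div_eq_inv_mul]
  have hlt : ∀ θ, ‖ev x θ‖ < 1 := fun θ => by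
    rw [hev, Complex.norm_real, Real.norm_eq_abs, abs_lt]
    have h1 : 0 < g θ / c := div_pos (hg θ) hc0
    have h2 : g θ / c < 1 := (div_lt_one hc0).2 (hgc θ)
    constructor <;> linarith
  -- This is the series of `-log (1 - x)`; its term at `n = 0` vanishes because `0⁻¹ = 0`.
  have hs : Summable fun n : ℕ => ((n : ℂ)⁻¹) • x ^ n := by
    refine Summable.of_norm_bounded (summable_norm_pow hlt) fun n => ?_
    rw [norm_smul, norm_inv, Complex.norm_natCast]
    refine mul_le_of_le_one_left (norm_nonneg _) ?_
    rcases n.eq_zero_or_pos with rfl | hn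
    · simp
    · exact inv_le_one_of_one_le₀ (by exact_mod_cast hn)
  obtain ⟨y, hy⟩ := hs
  refine ⟨(Real.log c : ℂ) • 1 - y, fun θ => ?_⟩
  have h1 := ev_hasSum hy θ
  have h2 := Complex.hasSum_taylorSeries_neg_log (hlt θ)
  have h3 : ev y θ = -Complex.log (1 - ev x θ) := by
    refine h1.unique (h2.congr_fun fun n => ?_)
    rw [map_smul, map_pow, ContinuousMap.smul_apply, ContinuousMap.pow_apply, smul_eq_mul,
      div_eq_inv_mul]
  have h4 : (1 : ℂ) - ev x θ = ((g θ / c : ℝ) : ℂ) := by rw [hev]; push_cast; ring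
  rw [map_sub, map_smul, map_one, ContinuousMap.sub_apply, h3, h4,
    ← Complex.ofReal_log (div_pos (hg θ) hc0).le, Real.log_div (hg θ).ne' hc0.ne']
  simp

theorem ev_exp (f : Wiener) (θ : AngleCircle) : ev (NormedSpace.exp f) θ = Complex.exp (ev f θ) := by
  have h1 := ev_hasSum (NormedSpace.exp_series_hasSum_exp' (𝕂 := ℂ) f) θ
  have h2 := NormedSpace.exp_series_hasSum_exp' (𝕂 := ℂ) (ev f θ)
  rw [← Complex.exp_eq_exp_ℂ] at h2
  refine h1.unique (h2.congr_fun fun n => ?_)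
  rw [map_smul, map_pow, ContinuousMap.smul_apply, ContinuousMap.pow_apply]

theorem coeff_hasSum {F : ℕ → Wiener} {f : Wiener} (h : HasSum F f) (k : ℤ) :
    HasSum (fun n => coeff k (F n)) (coeff k f) := h.map (coeff k) (continuous_coeff k)

theorem SuppGE.pow {f : Wiener} (hf : SuppGE 0 f) (n : ℕ) :
    SuppGE 0 (f ^ n) ∧ coeff 0 (f ^ n) = coeff 0 f ^ n := by
  induction n with
  | zero => simpa [coeff_one] using suppGE_one
  | succ n ih =>
    have h1 := ih.1.mul hf
    have h2 := ih.1.coeff_mul hf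
    rw [add_zero] at h1 h2
    rw [pow_succ, h2, ih.2, pow_succ]
    exact ⟨h1, rfl⟩

theorem SuppGE.exp {f : Wiener} (hf : SuppGE 0 f) :
    SuppGE 0 (NormedSpace.exp f) ∧ coeff 0 (NormedSpace.exp f) = Complex.exp (coeff 0 f) := by
  have h := NormedSpace.exp_series_hasSum_exp' (𝕂 := ℂ) f
  refine ⟨fun k hk => ?_, ?_⟩
  · refine (coeff_hasSum h k).unique (hasSum_zero.congr_fun fun n => ?_)
    rw [map_smul, (hf.pow n).1 k hk, smul_zero]
  · have h2 := NormedSpace.exp_series_hasSum_exp' (𝕂 := ℂ) (coeff 0 f)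
    rw [← Complex.exp_eq_exp_ℂ] at h2
    refine (coeff_hasSum h 0).unique (h2.congr_fun fun n => ?_)
    rw [map_smul, (hf.pow n).2]

/-- The Wiener-Hopf factorization of a positive function in the Wiener algebra. -/
theorem exists_factorization {f : Wiener} {g : AngleCircle → ℝ} (hg : ∀ θ, 0 < g θ)
    (hf : ∀ θ, ev f θ = g θ) : ∃ D E : Wiener, SuppGE 0 D ∧ SuppGE 0 E ∧ D * E = 1 ∧
      f = D * star D ∧ ∃ d : ℝ, 0 < d ∧ coeff 0 D = d := by
  obtain ⟨L, hL⟩ := exists_log hg hf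
  have hstar : star L = L := ext_ev fun θ => by rw [ev_star, hL, Complex.conj_ofReal]
  have hconj : ∀ k, conj (coeff (-k) L) = coeff k L := fun k => by rw [← coeff_star, hstar]
  obtain ⟨r, hr⟩ := Complex.conj_eq_iff_real.1 (by simpa using hconj 0)
  -- The mean `r` of the logarithm is real and is shared equally between `H` and `star H`, so that
  -- the mean of `D = exp H` is the positive number `exp (r / 2)`.
  set H : Wiener := ((r / 2 : ℝ) : ℂ) • 1 + proj {k | 0 < k} L with hH
  have hcoeff : ∀ k, coeff k H = if k = 0 then ((r / 2 : ℝ) : ℂ) else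
      if 0 < k then coeff k L else 0 := fun k => by
    rw [hH, map_add, coeff_smul_one, coeff_proj]
    rcases lt_trichotomy k 0 with h | h | h
    · simp [h.ne, h.not_gt]
    · simp [h]
    · simp [h.ne', h]
  have hsupp : SuppGE 0 H := fun k hk => by rw [hcoeff, if_neg hk.ne, if_neg hk.not_gt]
  have hadd : H + star H = L := ext_coeff fun k => by
    rw [map_add, coeff_star, hcoeff, hcoeff]
    rcases lt_trichotomy k 0 with h | h | h
    · rw [if_neg h.ne, if_neg h.not_gt, if_neg (by omega), if_pos (by omega), hconj, zero_add]
    · subst h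
      simp only [neg_zero, if_true, Complex.conj_ofReal]
      rw [hr]
      push_cast
      ring
    · rw [if_neg h.ne', if_pos h, if_neg (by omega), if_neg (by omega), map_zero, add_zero]
  have hneg : SuppGE 0 (-H) := by simpa using hsupp.smul (-1)
  refine ⟨NormedSpace.exp H, NormedSpace.exp (-H), hsupp.exp.1, hneg.exp.1, ext_ev fun θ => ?_,
    ext_ev fun θ => ?_, Real.exp (r / 2), Real.exp_pos _, ?_⟩
  · rw [map_mul, ContinuousMap.mul_apply, ev_exp, ev_exp, ← Complex.exp_add]
    simp
  · rw [map_mul, ContinuousMap.mul_apply, ev_star, ev_exp, ← Complex.exp_conj, ← Complex.exp_add,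
      ← ev_star, ← ContinuousMap.add_apply, ← map_add, hadd, hL, hf, ← Complex.ofReal_exp,
      Real.exp_log (hg θ)]
  · rw [hsupp.exp.2, hcoeff, if_pos rfl, Complex.ofReal_exp]

/-! ### Baxter's theorem -/

theorem tendsto_tsum_indicator_lt_neg {b : ℤ → ℝ} (hb : Summable b) (h0 : ∀ k, 0 ≤ b k) :
    Tendsto (fun n : ℕ => ∑' k, {k : ℤ | k < -(n : ℤ)}.indicator b k) atTop (𝓝 0) := by
  rw [← tsum_zero (α := ℝ) (β := ℤ)]
  refine tendsto_tsum_of_dominated_convergence hb (fun k => ?_) (Eventually.of_forall fun n k => ?_)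
  · refine tendsto_const_nhds.congr' ?_
    filter_upwards [eventually_ge_atTop k.natAbs] with n hn
    rw [Set.indicator_of_notMem]
    simp only [Set.mem_ofPred_eq]
    omega
  · rw [Real.norm_of_nonneg (Set.indicator_nonneg (fun k _ => h0 k) k)]
    exact Set.indicator_le_self' (fun k _ => h0 k) k

open Classical in
theorem norm_proj (s : Set ℤ) (f : Wiener) :
    ‖proj s f‖ = ∑' k, s.indicator (fun k => ‖coeff k f‖) k := by
  rw [norm_def]
  refine tsum_congr fun k => ?_
  rw [coeff_proj, Set.indicator_apply]
  split_ifs <;> simp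

theorem tendsto_norm_proj_lt_neg (f : Wiener) :
    Tendsto (fun n : ℕ => ‖proj {k | k < -(n : ℤ)} f‖) atTop (𝓝 0) := by
  simp only [norm_proj]
  exact tendsto_tsum_indicator_lt_neg f.summable_norm_coeff fun k => norm_nonneg _

/-- An exact equality, special to the `ℓ¹` norm; the telescoping bound for the Verblunsky
coefficients rests on it. -/
theorem norm_sub_coeff_smul_mono (k : ℤ) (f : Wiener) :
    ‖f - coeff k f • mono k‖ = ‖f‖ - ‖coeff k f‖ := by
  rw [norm_def f, f.summable_norm_coeff.tsum_eq_add_tsum_ite k, add_sub_cancel_left, norm_def]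
  refine tsum_congr fun n => ?_
  rw [map_sub, map_smul, coeff_mono]
  split_ifs with h
  · simp [h]
  · simp

theorem suppGE_proj_compl_lt (m : ℤ) (f : Wiener) : SuppGE m (f - proj {k | k < m} f) :=
  fun k hk => by rw [map_sub, coeff_proj_of_mem f (s := {k | k < m}) hk, sub_self]

/-- The reversal `z ^ n * conj f`. -/
def rev (n : ℤ) (f : Wiener) : Wiener := mono n * star f

theorem coeff_rev (n k : ℤ) (f : Wiener) : coeff k (rev n f) = conj (coeff (n - k) f) := by
  rw [rev, coeff_mono_mul, coeff_star, neg_sub]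

theorem star_rev (n : ℤ) (f : Wiener) : star (rev n f) = mono (-n) * f := by
  rw [rev, star_mul', star_star, star_mono]

/-- The monic orthogonal polynomials `q n` with Verblunsky coefficients `α n` and squared norms
`c n` of a weight `f`, in terms of Fourier coefficients. -/
structure IsOPSystem (f : Wiener) (q : ℕ → Wiener) (α : ℕ → ℂ) (c : ℕ → ℝ) : Prop where
  star_weight : star f = f
  succ : ∀ n, q (n + 1) = mono 1 * q n - conj (α n) • rev n (q n)
  suppGE : ∀ n, SuppGE 0 (q n)
  suppLE : ∀ n : ℕ, SuppLE (n : ℤ) (q n)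
  monic : ∀ n : ℕ, coeff n (q n) = 1
  orthogonal : ∀ n : ℕ, ∀ k : ℤ, 0 ≤ k → k < n → coeff k (f * q n) = 0
  norm_sq : ∀ n : ℕ, coeff n (f * q n) = c n

/-! ### Frequency splitting of `f Φ_n^*`. -/

namespace IsOPSystem

variable {f : Wiener} {q : ℕ → Wiener} {α : ℕ → ℂ} {c : ℕ → ℝ}

theorem rev_suppGE (h : IsOPSystem f q α c) (n : ℕ) : SuppGE 0 (rev n (q n)) := fun k hk => by
  rw [coeff_rev, h.suppLE n _ (by omega), map_zero]

theorem rev_suppLE (h : IsOPSystem f q α c) (n : ℕ) : SuppLE n (rev n (q n)) := fun k hk => by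
  rw [coeff_rev, h.suppGE n _ (by omega), map_zero]

/-- The recurrence for the reversed polynomials. -/
theorem rev_succ (h : IsOPSystem f q α c) (n : ℕ) : rev (n + 1 : ℕ) (q (n + 1)) =
    rev n (q n) - α n • (mono (n + 1) * star (rev n (q n))) := by
  rw [rev, h.succ, star_sub, star_mul', star_mono, star_smul, mul_sub, mul_smul_comm, ← mul_assoc,
    ← mono_add, rev]
  simp only [Nat.cast_add, Nat.cast_one, RCLike.star_def, Complex.conj_conj]
  rw [show (n : ℤ) + 1 + -1 = n by ring]

theorem rev_coeff_zero (h : IsOPSystem f q α c) (n : ℕ) : coeff 0 (rev n (q n)) = 1 := by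
  rw [coeff_rev, sub_zero, h.monic, map_one]

theorem coeff_weight_mul_rev (h : IsOPSystem f q α c) (n : ℕ) (k : ℤ) :
    coeff k (f * rev n (q n)) = conj (coeff (n - k) (f * q n)) := by
  rw [rev, mul_left_comm, ← coeff_rev, rev, star_mul', h.star_weight]

/-- The part of `f φ_n^*` of nonpositive frequencies. -/
def lo (f : Wiener) (q : ℕ → Wiener) (n : ℕ) : Wiener := proj {k | k ≤ 0} (f * rev n (q n))

/-- The part of `f φ_n^*` of frequencies above `n`. -/
def hi (f : Wiener) (q : ℕ → Wiener) (n : ℕ) : Wiener := proj {k | (n : ℤ) < k} (f * rev n (q n))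

theorem lo_suppLE (f : Wiener) (q : ℕ → Wiener) (n : ℕ) : SuppLE 0 (lo f q n) := fun k hk =>
  coeff_proj_of_notMem _ (by simpa using hk)

theorem hi_suppGE (f : Wiener) (q : ℕ → Wiener) (n : ℕ) : SuppGE (n + 1) (hi f q n) := fun k hk =>
  coeff_proj_of_notMem _ (by simp only [Set.mem_ofPred_eq]; omega)

/-- Orthogonality says that `f Φ_n` has no frequencies `0, …, n - 1`. As `f` is real, reversal turns
this into the absence of `1, …, n` in `f Φ_n^*`. -/
theorem lo_add_hi (h : IsOPSystem f q α c) (n : ℕ) : lo f q n + hi f q n = f * rev n (q n) :=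
  ext_coeff fun k => by
    rw [map_add, lo, hi]
    rcases le_or_gt k 0 with h0 | h0
    · rw [coeff_proj_of_mem (s := {k | k ≤ 0}) _ h0, coeff_proj_of_notMem, add_zero]
      simp only [Set.mem_ofPred_eq]
      omega
    · rw [coeff_proj_of_notMem _ (by simpa using h0), zero_add]
      rcases le_or_gt k n with h1 | h1
      · rw [coeff_proj_of_notMem _ (by simpa using h1), h.coeff_weight_mul_rev,
          h.orthogonal n _ (by omega) (by omega), map_zero]
      · rw [coeff_proj_of_mem (s := {k | (n : ℤ) < k}) _ h1]

theorem lo_coeff_zero (h : IsOPSystem f q α c) (n : ℕ) : coeff 0 (lo f q n) = c n := by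
  rw [lo, coeff_proj_of_mem _ (by simp), h.coeff_weight_mul_rev, sub_zero, h.norm_sq,
    Complex.conj_ofReal]

/-- Multiply the recurrence for `Φ_n^*` by the real function `f`. The map `g ↦ z^{n+1} conj g`
exchanges frequencies `≤ 0` with frequencies `≥ n + 1`, so the high part receives a correction from
the low part only. -/
theorem hi_succ (h : IsOPSystem f q α c) (n : ℕ) :
    hi f q (n + 1) = hi f q n - α n • (mono (n + 1) * star (lo f q n)) := by
  have h1 : f * rev (n + 1 : ℕ) (q (n + 1)) = lo f q n + hi f q n -
      α n • (mono (n + 1) * star (lo f q n) + mono (n + 1) * star (hi f q n)) := by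
    rw [h.rev_succ, mul_sub, ← h.lo_add_hi, mul_smul_comm, mul_left_comm, ← mul_add,
      ← star_add, h.lo_add_hi, star_mul', h.star_weight]
  refine ext_coeff fun k => ?_
  rcases le_or_gt k n with hk | hk
  · rw [map_sub, map_smul, hi_suppGE f q (n + 1) k (by push_cast; omega),
      hi_suppGE f q n k (by omega), coeff_mono_mul, coeff_star, lo_suppLE f q n _ (by omega)]
    simp
  · have h2 : coeff k (hi f q (n + 1)) = coeff k (f * rev (n + 1 : ℕ) (q (n + 1))) := by
      rw [← h.lo_add_hi, map_add, lo_suppLE f q _ k (by omega), zero_add]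
    rw [h2, h1, map_sub, map_add, map_smul, map_add, coeff_mono_mul _ _ (star (hi f q n)),
      coeff_star (hi f q n), hi_suppGE f q n (-(k - (n + 1))) (by omega),
      lo_suppLE f q n k (by omega), map_zero, add_zero, zero_add, map_sub, map_smul]

/-! ### Estimates from the factorization `f = D * star D`. -/

variable {D F : Wiener} {d : ℝ}

section Factorization

/-- `f φ_n^*` of nonpositive frequencies, divided by `conj D`. -/
def loQuot (f F : Wiener) (q : ℕ → Wiener) (n : ℕ) : Wiener := lo f q n * star F

/-- `f φ_n^*` of frequencies above `n`, divided by `D`. -/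
def hiQuot (f F : Wiener) (q : ℕ → Wiener) (n : ℕ) : Wiener := hi f q n * F

theorem loQuot_suppLE (hF : SuppGE 0 F) (n : ℕ) : SuppLE 0 (loQuot f F q n) := by
  simpa [loQuot] using (lo_suppLE f q n).mul hF.star

theorem hiQuot_suppGE (hF : SuppGE 0 F) (n : ℕ) : SuppGE (n + 1) (hiQuot f F q n) := by
  simpa [hiQuot] using (hi_suppGE f q n).mul hF

/-- Together with `star_D_mul_rev` this gives two equations linking the quotients through `D * star
F` and its conjugate. The left sides are supported in frequencies `≥ 0` here and `≤ n` there, which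
is all that the estimates use. -/
theorem D_mul_rev (h : IsOPSystem f q α c) (hDF : D * F = 1) (hf : f = D * star D) (n : ℕ) :
    D * rev n (q n) = loQuot f F q n + hiQuot f F q n * (D * star F) := by
  have hs : star D * star F = 1 := by rw [← star_mul', hDF, star_one]
  have h1 := h.lo_add_hi n
  rw [loQuot, hiQuot]
  linear_combination (-(star F)) * h1 + hi f q n * star F * (-hDF) +
    (star F * rev n (q n)) * hf.symm - (D * rev n (q n)) * hs

theorem star_D_mul_rev (h : IsOPSystem f q α c) (hDF : D * F = 1) (hf : f = D * star D) (n : ℕ) :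
    star D * rev n (q n) = loQuot f F q n * star (D * star F) + hiQuot f F q n := by
  have hs : star D * star F = 1 := by rw [← star_mul', hDF, star_one]
  have h1 := h.lo_add_hi n
  rw [loQuot, hiQuot, star_mul', star_star]
  linear_combination (-F) * h1 + lo f q n * F * (-hs) +
    (F * rev n (q n)) * hf.symm - (star D * rev n (q n)) * hDF

/-- Above frequency `n` the left side of `star_D_mul_rev` vanishes, so there `hiQuot` is minus the
product of `loQuot` with `star (D * star F)`. Since `loQuot` has frequencies `≤ 0`, only the part of
`D * star F` below `-n` contributes. -/
theorem norm_hiQuot_le (h : IsOPSystem f q α c) (hD : SuppGE 0 D) (hF : SuppGE 0 F)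
    (hDF : D * F = 1) (hf : f = D * star D) (n : ℕ) :
    ‖hiQuot f F q n‖ ≤ ‖proj {k | k < -(n : ℤ)} (D * star F)‖ * ‖loQuot f F q n‖ := by
  set S := D * star F
  set T := proj {k | k < -(n : ℤ)} S
  rw [mul_comm, ← norm_star T]
  refine le_trans (norm_le_of_coeff fun k => ?_) (norm_mul_le _ _)
  rcases le_or_gt k n with hk | hk
  · rw [hiQuot_suppGE hF n k (by omega), norm_zero]
    exact norm_nonneg _
  · have h1 := congrArg (coeff k) (h.star_D_mul_rev hDF hf n)
    have h2 : SuppLE n (star D * rev n (q n)) := by simpa using hD.star.mul (h.rev_suppLE n)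
    have h3 : SuppLE n (loQuot f F q n * star (S - T)) := by
      have := (loQuot_suppLE (q := q) (f := f) hF n).mul (suppGE_proj_compl_lt (-(n : ℤ)) S).star
      simpa using this
    have h4 : loQuot f F q n * star S = loQuot f F q n * star (S - T) +
        loQuot f F q n * star T := by rw [star_sub]; ring
    rw [h2 k hk, map_add, h4, map_add, h3 k hk, zero_add] at h1
    rw [← norm_neg, ← eq_neg_of_add_eq_zero_left h1.symm]

/-- The frequencies of `hiQuot` start at `n + 1`, so the part of `S` from `-n` on produces only
positive frequencies. -/
theorem coeff_hiQuot_mul (hF : SuppGE 0 F) (S : Wiener) (n : ℕ) {k : ℤ} (hk : k ≤ 0) :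
    coeff k (hiQuot f F q n * S) =
      coeff k (hiQuot f F q n * proj {k | k < -(n : ℤ)} S) := by
  set T := proj {k | k < -(n : ℤ)} S
  have h3 : SuppGE 1 (hiQuot f F q n * (S - T)) := by
    have := (hiQuot_suppGE (q := q) (f := f) hF n).mul (suppGE_proj_compl_lt (-(n : ℤ)) S)
    exact this.mono_le (by omega)
  have h4 : hiQuot f F q n * S = hiQuot f F q n * (S - T) + hiQuot f F q n * T := by ring
  rw [h4, map_add, h3 k (by omega), zero_add]

/-- The counterpart of `norm_hiQuot_le`: at negative frequencies the left side of `D_mul_rev`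
vanishes and `coeff_hiQuot_mul` localizes the product. -/
theorem norm_loQuot_sub_le (h : IsOPSystem f q α c) (hD : SuppGE 0 D) (hF : SuppGE 0 F)
    (hDF : D * F = 1) (hf : f = D * star D) (n : ℕ) :
    ‖loQuot f F q n - coeff 0 (loQuot f F q n) • 1‖ ≤
      ‖proj {k | k < -(n : ℤ)} (D * star F)‖ * ‖hiQuot f F q n‖ := by
  rw [mul_comm]
  refine le_trans (norm_le_of_coeff fun k => ?_) (norm_mul_le _ _)
  rw [map_sub, coeff_smul_one]
  rcases lt_trichotomy k 0 with hk | hk | hk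
  · have h1 := congrArg (coeff k) (h.D_mul_rev hDF hf n)
    have h2 : SuppGE 0 (D * rev n (q n)) := by simpa using hD.mul (h.rev_suppGE n)
    rw [h2 k hk, map_add, coeff_hiQuot_mul hF _ n hk.le] at h1
    rw [if_neg hk.ne, sub_zero, ← norm_neg, ← eq_neg_of_add_eq_zero_right h1.symm]
  · rw [if_pos hk, hk, sub_self, norm_zero]
    exact norm_nonneg _
  · rw [if_neg hk.ne', loQuot_suppLE hF n k hk, sub_zero, norm_zero]
    exact norm_nonneg _

/-- The zeroth coefficient of `D_mul_rev`: as `Φ_n^*` has constant term `1`, its left side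
contributes exactly `coeff 0 D`. -/
theorem norm_coeff_loQuot_sub_le (h : IsOPSystem f q α c) (hD : SuppGE 0 D) (hF : SuppGE 0 F)
    (hDF : D * F = 1) (hf : f = D * star D) (n : ℕ) :
    ‖coeff 0 (loQuot f F q n) - coeff 0 D‖ ≤
      ‖proj {k | k < -(n : ℤ)} (D * star F)‖ * ‖hiQuot f F q n‖ := by
  rw [mul_comm]
  refine le_trans ?_ (norm_mul_le _ _)
  refine le_trans ?_ (norm_coeff_le 0 _)
  have h1 := congrArg (coeff 0) (h.D_mul_rev hDF hf n)
  have h2 := hD.coeff_mul (h.rev_suppGE n)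
  rw [add_zero, h.rev_coeff_zero, mul_one] at h2
  rw [h2, map_add, coeff_hiQuot_mul hF _ n le_rfl] at h1
  rw [h1, sub_add_cancel_left, norm_neg]

/-- The basic estimates, in terms of the tail of the Fourier series of `D / conj D`. -/
theorem eventually_norm_quot_le (h : IsOPSystem f q α c) (hD : SuppGE 0 D) (hF : SuppGE 0 F)
    (hDF : D * F = 1) (hf : f = D * star D) :
    ∀ᶠ n : ℕ in atTop,
      ‖hiQuot f F q n‖ ≤ 2 * ‖coeff 0 D‖ * ‖proj {k | k < -(n : ℤ)} (D * star F)‖ ∧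
      ‖loQuot f F q n - coeff 0 (loQuot f F q n) • 1‖ ≤
        ‖coeff 0 D‖ / 2 * ‖proj {k | k < -(n : ℤ)} (D * star F)‖ ∧
      ‖coeff 0 (loQuot f F q n) - coeff 0 D‖ ≤
        ‖coeff 0 D‖ / 2 * ‖proj {k | k < -(n : ℤ)} (D * star F)‖ ∧
      ‖proj {k | k < -(n : ℤ)} (D * star F)‖ ≤ 1 / 4 := by
  filter_upwards [(tendsto_norm_proj_lt_neg (D * star F)).eventually_le_const
    (show (0 : ℝ) < 1 / 4 by norm_num)] with n hn
  have h1 := h.norm_hiQuot_le hD hF hDF hf n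
  have h2 := h.norm_loQuot_sub_le hD hF hDF hf n
  have h3 := h.norm_coeff_loQuot_sub_le hD hF hDF hf n
  set τ := ‖proj {k | k < -(n : ℤ)} (D * star F)‖
  set G := loQuot f F q n
  set H := hiQuot f F q n
  have hτ : 0 ≤ τ := norm_nonneg _
  have h4 : ‖G‖ ≤ ‖G - coeff 0 G • 1‖ + ‖coeff 0 G‖ := by
    calc ‖G‖ = ‖(G - coeff 0 G • 1) + coeff 0 G • (1 : Wiener)‖ := by rw [sub_add_cancel]
      _ ≤ ‖G - coeff 0 G • 1‖ + ‖coeff 0 G • (1 : Wiener)‖ := norm_add_le _ _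
      _ = _ := by rw [norm_smul, norm_one, mul_one]
  have h5 : ‖coeff 0 G‖ ≤ ‖coeff 0 G - coeff 0 D‖ + ‖coeff 0 D‖ := by
    simpa using norm_add_le (coeff 0 G - coeff 0 D) (coeff 0 D)
  have h6 : ‖H‖ ≤ 1 / 4 * ‖G‖ := h1.trans (by gcongr)
  have h7 : τ * ‖H‖ ≤ 1 / 4 * ‖H‖ := by gcongr
  -- The preceding bounds combine to `‖G‖ ≤ ‖coeff 0 D‖ + ‖H‖ / 2` and `‖H‖ ≤ ‖G‖ / 4`, so `‖G‖` can
  -- be absorbed.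
  have h8 : ‖G‖ ≤ 2 * ‖coeff 0 D‖ := by linarith [norm_nonneg G]
  have h9 : ‖H‖ ≤ ‖coeff 0 D‖ / 2 := by linarith
  have h10 : τ * ‖H‖ ≤ ‖coeff 0 D‖ / 2 * τ := by rw [mul_comm]; gcongr
  refine ⟨h1.trans ?_, h2.trans h10, h3.trans h10, hn⟩
  rw [mul_comm]
  gcongr

theorem tendsto_coeff_loQuot (h : IsOPSystem f q α c) (hD : SuppGE 0 D) (hF : SuppGE 0 F)
    (hDF : D * F = 1) (hf : f = D * star D) :
    Tendsto (fun n => coeff 0 (loQuot f F q n)) atTop (𝓝 (coeff 0 D)) := by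
  rw [tendsto_iff_norm_sub_tendsto_zero]
  refine squeeze_zero' (Eventually.of_forall fun n => norm_nonneg _)
    ((h.eventually_norm_quot_le hD hF hDF hf).mono fun n hn => hn.2.2.1) ?_
  simpa using (tendsto_norm_proj_lt_neg (D * star F)).const_mul (‖coeff 0 D‖ / 2)

/-- In `D_mul_rev` the quotient `hiQuot` tends to `0` and `loQuot` to the constant `coeff 0 D`;
multiplication by `F` then isolates `Φ_n^*`. -/
theorem tendsto_rev (h : IsOPSystem f q α c) (hD : SuppGE 0 D) (hF : SuppGE 0 F)
    (hDF : D * F = 1) (hf : f = D * star D) :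
    Tendsto (fun n : ℕ => rev n (q n)) atTop (𝓝 (coeff 0 D • F)) := by
  have hτ := tendsto_norm_proj_lt_neg (D * star F)
  have hev := h.eventually_norm_quot_le hD hF hDF hf
  have hH : Tendsto (fun n => hiQuot f F q n) atTop (𝓝 0) := by
    rw [tendsto_zero_iff_norm_tendsto_zero]
    refine squeeze_zero' (Eventually.of_forall fun n => norm_nonneg _) (hev.mono fun n hn => hn.1) ?_
    simpa using hτ.const_mul (2 * ‖coeff 0 D‖)
  have hG : Tendsto (fun n => loQuot f F q n - coeff 0 (loQuot f F q n) • 1) atTop (𝓝 0) := by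
    rw [tendsto_zero_iff_norm_tendsto_zero]
    refine squeeze_zero' (Eventually.of_forall fun n => norm_nonneg _)
      (hev.mono fun n hn => hn.2.1) ?_
    simpa using hτ.const_mul (‖coeff 0 D‖ / 2)
  have hG0 := (h.tendsto_coeff_loQuot hD hF hDF hf).smul_const (1 : Wiener)
  have key := ((hG.add hG0).add (hH.mul_const (D * star F))).const_mul F
  rw [zero_mul, zero_add, add_zero, mul_smul_comm, mul_one] at key
  refine key.congr fun n => ?_
  have h1 := h.D_mul_rev hDF hf n
  rw [sub_add_cancel]
  linear_combination (-F) * h1 + rev n (q n) * hDF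

/-- Links the quotients with the squared norms of the monic polynomials, and thereby yields the
limit of `kappa`. -/
theorem coeff_loQuot (h : IsOPSystem f q α c) (hF : SuppGE 0 F) (n : ℕ) :
    coeff 0 (loQuot f F q n) = c n * conj (coeff 0 F) := by
  have h1 := (lo_suppLE f q n).star.coeff_mul hF
  have h2 : star (star (lo f q n) * F) = loQuot f F q n := by rw [star_mul', star_star]; rfl
  rw [← h2, coeff_star]
  simp only [neg_zero, add_zero] at h1 ⊢
  rw [h1, coeff_star, neg_zero, h.lo_coeff_zero, map_mul, Complex.conj_conj]

theorem tendsto_norm_sq (h : IsOPSystem f q α c) (hD : SuppGE 0 D) (hF : SuppGE 0 F)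
    (hDF : D * F = 1) (hf : f = D * star D) (hd0 : 0 < d) (hd : coeff 0 D = d) :
    Tendsto c atTop (𝓝 (d ^ 2)) := by
  have h1 := h.tendsto_coeff_loQuot hD hF hDF hf
  have h2 := hD.coeff_mul hF
  rw [hDF, add_zero, coeff_one, if_pos rfl, hd] at h2
  have hdc : (d : ℂ) ≠ 0 := by exact_mod_cast hd0.ne'
  have h3 : coeff 0 F = ((d⁻¹ : ℝ) : ℂ) := by
    push_cast
    exact eq_inv_of_mul_eq_one_right h2.symm
  have h4 := (Complex.continuous_re.tendsto _).comp (h1.mul_const (d : ℂ))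
  rw [hd, ← Complex.ofReal_mul, Complex.ofReal_re, ← sq] at h4
  refine h4.congr fun n => ?_
  rw [Function.comp_apply, h.coeff_loQuot hF, h3, Complex.conj_ofReal, ← Complex.ofReal_mul,
    ← Complex.ofReal_mul, Complex.ofReal_re, mul_assoc, inv_mul_cancel₀ hd0.ne', mul_one]

theorem hiQuot_succ (h : IsOPSystem f q α c) (n : ℕ) :
    hiQuot f F q (n + 1) = hiQuot f F q n - α n • (mono (n + 1) * star (loQuot f F q n)) := by
  rw [hiQuot, h.hi_succ, hiQuot, loQuot, star_mul', star_star, sub_mul, smul_mul_assoc, mul_assoc]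

/-- Baxter's theorem: the Verblunsky coefficients are summable. -/
theorem summable_norm (h : IsOPSystem f q α c) (hD : SuppGE 0 D) (hF : SuppGE 0 F)
    (hDF : D * F = 1) (hf : f = D * star D) : Summable fun n => ‖α n‖ := by
  have hd : 0 < ‖coeff 0 D‖ := by
    have h2 := hD.coeff_mul hF
    rw [hDF, add_zero, coeff_one, if_pos rfl] at h2
    exact norm_pos_iff.2 (left_ne_zero_of_mul (h2 ▸ one_ne_zero))
  obtain ⟨N, hN⟩ := eventually_atTop.1 (h.eventually_norm_quot_le hD hF hDF hf)
  -- The norm of `hiQuot` acts as a Lyapunov function: each step consumes a fixed multiple of `‖α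
  -- n‖`.
  have step : ∀ n ≥ N, ‖α n‖ * (‖coeff 0 D‖ / 2) ≤ ‖hiQuot f F q n‖ - ‖hiQuot f F q (n + 1)‖ := by
    intro n hn
    obtain ⟨-, h2, h3, h4⟩ := hN n hn
    set G := loQuot f F q n
    set H := hiQuot f F q n
    have hs := h.hiQuot_succ (F := F) n
    -- The frequency `n + 1` is absent from `hiQuot f F q (n + 1)`, so the two terms of
    -- `hiQuot_succ` cancel there.
    have hc : coeff (n + 1) H = α n * conj (coeff 0 G) := by
      have h5 := congrArg (coeff (n + 1)) hs
      rw [hiQuot_suppGE hF (n + 1) _ (by push_cast; omega), map_sub, map_smul, coeff_mono_mul,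
        coeff_star] at h5
      simp only [sub_self, neg_zero, smul_eq_mul] at h5
      exact sub_eq_zero.1 h5.symm
    have h6 : hiQuot f F q (n + 1) = (H - coeff (n + 1) H • mono (n + 1)) -
        α n • (mono (n + 1) * star (G - coeff 0 G • 1)) := by
      rw [hs, hc, star_sub, star_smul, star_one, mul_sub, mul_smul_comm, mul_one, smul_sub,
        smul_smul]
      simp only [RCLike.star_def]
      abel
    have h7 : ‖hiQuot f F q (n + 1)‖ ≤ ‖H‖ - ‖α n‖ * ‖coeff 0 G‖ +
        ‖α n‖ * ‖G - coeff 0 G • 1‖ := by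
      rw [h6]
      refine (norm_sub_le _ _).trans (le_of_eq ?_)
      rw [norm_sub_coeff_smul_mono, hc, norm_smul, norm_mono_mul, norm_star, norm_mul,
        RCLike.norm_conj]
    have h8 : ‖coeff 0 D‖ - ‖coeff 0 G‖ ≤ ‖coeff 0 G - coeff 0 D‖ := by
      rw [← norm_neg (_ - _), neg_sub]
      exact norm_sub_norm_le _ _
    have h9 : ‖coeff 0 D‖ / 2 * ‖proj {k | k < -(n : ℤ)} (D * star F)‖ ≤
        ‖coeff 0 D‖ / 2 * (1 / 4) := by gcongr
    -- Both errors are at most `‖coeff 0 D‖ / 8`, because the tail is at most `1 / 4`.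
    have h10 : ‖coeff 0 D‖ / 2 ≤ ‖coeff 0 G‖ - ‖G - coeff 0 G • 1‖ := by linarith
    nlinarith [mul_le_mul_of_nonneg_left h10 (norm_nonneg (α n))]
  rw [← summable_nat_add_iff N]
  refine summable_of_sum_range_le (c := ‖hiQuot f F q N‖ / (‖coeff 0 D‖ / 2))
    (fun n => norm_nonneg _) fun m => ?_
  rw [le_div_iff₀ (by positivity), Finset.sum_mul]
  have : ∑ i ∈ Finset.range m, ‖α (i + N)‖ * (‖coeff 0 D‖ / 2) ≤
      ∑ i ∈ Finset.range m, (‖hiQuot f F q (i + N)‖ - ‖hiQuot f F q (i + 1 + N)‖) := by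
    refine Finset.sum_le_sum fun i _ => ?_
    rw [show i + 1 + N = i + N + 1 by ring]
    exact step _ (by omega)
  rw [Finset.sum_range_sub' (fun i => ‖hiQuot f F q (i + N)‖), zero_add] at this
  linarith [norm_nonneg (hiQuot f F q (m + N))]

end Factorization
end IsOPSystem
end Wiener

open Wiener

/-! ### Functions on the circle as elements of the Wiener algebra -/

theorem memA_ev_iff (ν : ℤ → ℝ) (f : Wiener) :
    MemA ν (ev f) ↔ Summable fun k => ν k * ‖coeff k f‖ :=
  and_iff_left fun θ => f.hasSum_eval θ

theorem memA_one_ev (f : Wiener) : MemA (fun _ => 1) (ev f) :=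
  (memA_ev_iff _ f).2 (by simpa using f.summable_norm_coeff)

theorem exists_wiener_of_memA {g : AngleCircle → ℂ} (hg : MemA (fun _ => 1) g) :
    ∃ f : Wiener, ∀ θ, ev f θ = g θ := by
  have hs : Summable (fourierCoeff g) := .of_norm (by simpa [MemA, MemEll] using hg.1)
  obtain ⟨f, hf⟩ := exists_coeff_eq hs
  refine ⟨f, fun θ => (f.hasSum_eval θ).unique ?_⟩
  simpa only [hf] using hg.2 θ

theorem normA_one_ev (f : Wiener) : normA (fun _ => 1) (ev f) = ‖f‖ := by
  simp only [normA, one_mul, norm_def, fourierCoeff_ev]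

theorem tendstoA_ev {F : ℕ → Wiener} {f : Wiener} (h : Tendsto F atTop (𝓝 f)) :
    TendstoA (fun _ => 1) (fun n => ev (F n)) (ev f) := by
  refine ⟨fun n => memA_one_ev _, memA_one_ev _, ?_⟩
  have h1 : ∀ n, (ev (F n) : AngleCircle → ℂ) - ev f = ev (F n - f) := fun n => by
    rw [map_sub]; rfl
  simp only [h1, normA_one_ev]
  exact tendsto_iff_norm_sub_tendsto_zero.1 h

theorem projMinus_ev (f : Wiener) : projMinus (ev f) = ev (proj {k | k ≤ 0} f) := by
  funext θ
  refine ((hasSum_eval _ θ).congr_fun fun k => ?_).tsum_eq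
  rw [coeff_proj, seqProjMinus, fourierCoeff_ev]
  by_cases hk : k ≤ 0 <;> simp [hk]

theorem memAMinus_projMinus_ev_iff (ν : ℤ → ℝ) (f : Wiener) :
    MemAMinus ν (projMinus (ev f)) ↔
      Summable fun k => ν k * ‖coeff k (proj {k | k ≤ 0} f)‖ := by
  rw [projMinus_ev, MemAMinus, memA_ev_iff, and_iff_left]
  intro k hk
  exact coeff_proj_of_notMem _ (by simpa using hk)

/-! ### The orthogonal polynomials in the Wiener algebra -/

theorem ev_aeval (p : ℂ[X]) (θ : AngleCircle) : ev (aeval (mono 1) p) θ = p.eval (pt θ) := by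
  induction p using Polynomial.induction_on' with
  | add p q hp hq => rw [map_add, map_add, ContinuousMap.add_apply, hp, hq, eval_add]
  | monomial n a =>
    rw [aeval_monomial, eval_monomial, map_mul, map_pow, AlgHomClass.commutes,
      ContinuousMap.mul_apply, ContinuousMap.pow_apply, ev_mono, zpow_one]
    simp [Algebra.algebraMap_eq_smul_one]

theorem coeff_aeval (p : ℂ[X]) (k : ℤ) :
    Wiener.coeff k (aeval (mono 1) p) = if 0 ≤ k then p.coeff k.toNat else 0 := by
  induction p using Polynomial.induction_on' with
  | add p q hp hq =>
    rw [map_add, map_add, hp, hq]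
    split_ifs <;> simp
  | monomial n a =>
    rw [aeval_monomial, ← Algebra.smul_def, map_smul, mono_pow, coeff_mono, one_mul,
      coeff_monomial]
    by_cases h : k = n
    · simp [h]
    · rw [if_neg h]
      split_ifs with h1 h2
      · exact absurd h2 (by omega)
      · simp
      · simp

theorem aeval_reversed {n : ℕ} {p : ℂ[X]} (hp : p.natDegree ≤ n) :
    aeval (mono 1) (reversed n p) = rev n (aeval (mono 1) p) := ext_ev fun θ => by
  rw [ev_aeval, eval_reversed hp, rev, map_mul, ContinuousMap.mul_apply, ev_mono, ev_star, ev_aeval,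
    zpow_natCast]

/-! ### Passage from the weight `w` to the Wiener algebra, and the limits `f_+`, `f_-`. -/

section Weight

variable {w : AngleCircle → ℝ} {f : Wiener}

theorem continuous_weight (hf : ∀ θ, ev f θ = w θ) : Continuous w := by
  have h : w = fun θ => (ev f θ).re := funext fun θ => by rw [hf, Complex.ofReal_re]
  rw [h]
  exact Complex.continuous_re.comp (ev f).continuous

theorem isFiniteMeasure_weightMeasure (hf : ∀ θ, ev f θ = w θ) :
    IsFiniteMeasure (weightMeasure w) :=
  isFiniteMeasure_withDensity_ofReal
    ((continuous_weight hf).integrable_of_hasCompactSupport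
      (HasCompactSupport.of_compactSpace _)).2

/-- The factor `(2 * π)⁻¹` cancels the total mass of `dθ`, leaving the probability measure that
defines `fourierCoeff`. -/
theorem ip_weightMeasure (hpos : ∀ θ, 0 < w θ) (hf : ∀ θ, ev f θ = w θ) (p q : ℂ[X]) :
    ip (weightMeasure w) p q =
      Wiener.coeff 0 (f * aeval (mono 1) p * star (aeval (mono 1) q)) := by
  have hm : Measurable fun θ => ENNReal.ofReal (w θ) :=
    (continuous_weight hf).measurable.ennreal_ofReal
  rw [ip, weightMeasure, integral_withDensity_eq_integral_toReal_smul hm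
    (Eventually.of_forall fun θ => ENNReal.ofReal_lt_top), ← fourierCoeff_ev, fourierCoeff,
    AddCircle.volume_eq_smul_haarAddCircle, integral_smul_measure,
    ENNReal.toReal_ofReal Real.two_pi_pos.le]
  have h0 : (2 * π : ℂ) ≠ 0 := by exact_mod_cast Real.two_pi_pos.ne'
  rw [Complex.real_smul]
  push_cast
  rw [inv_mul_cancel_left₀ h0]
  congr 1
  funext θ
  rw [map_mul, map_mul, ContinuousMap.mul_apply, ContinuousMap.mul_apply, ev_star, ev_aeval,
    ev_aeval, hf, ENNReal.toReal_ofReal (hpos θ).le, Complex.real_smul]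
  simp [mul_assoc]

/-- The monic orthogonal polynomials of a positive weight in the Wiener algebra. -/
theorem isOPSystem_monicOP (hpos : ∀ θ, 0 < w θ) (hf : ∀ θ, ev f θ = w θ) :
    IsOPSystem f (fun n => aeval (mono 1) (monicOP (weightMeasure w) n))
      (verblunsky (weightMeasure w))
      (fun n => (ip (weightMeasure w) (monicOP (weightMeasure w) n)
        (monicOP (weightMeasure w) n)).re) := by
  have _ := isFiniteMeasure_weightMeasure hf
  have hμ := weightMeasure_definite (continuous_weight hf).measurable hpos
  set μ := weightMeasure w
  -- Pairing with `z^k` reads off a Fourier coefficient of `f Φ_n`, so orthogonality becomes the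
  -- vanishing of coefficients.
  have hcoeff : ∀ (n : ℕ) (k : ℕ), Wiener.coeff k (f * aeval (mono 1) (monicOP μ n)) =
      ip μ (monicOP μ n) (X ^ k) := fun n k => by
    rw [ip_weightMeasure hpos hf, map_pow, aeval_X, mono_pow, star_mono, mul_comm _ (mono _),
      coeff_mono_mul]
    simp
  refine ⟨ext_ev fun θ => ?_, fun n => ?_, fun n k hk => ?_, fun n k hk => ?_, fun n => ?_,
    fun n k h0 hk => ?_, fun n => ?_⟩
  · rw [ev_star, hf, Complex.conj_ofReal]
  · rw [monicOP_succ hμ n, map_sub, map_mul, map_mul, aeval_X, aeval_C,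
      aeval_reversed (monicOP_natDegree n).le, Algebra.smul_def]
  · rw [coeff_aeval, if_neg (by omega)]
  · rw [coeff_aeval, if_pos (by omega), coeff_eq_zero_of_natDegree_lt]
    rw [monicOP_natDegree]
    omega
  · rw [coeff_aeval, if_pos (by omega), Int.toNat_natCast, monicOP_coeff]
  · obtain ⟨k, rfl⟩ := Int.eq_ofNat_of_zero_le h0
    rw [hcoeff, ← ip_conj, ip_monicOP_of_degree_lt hμ, map_zero]
    rw [degree_X_pow]
    exact_mod_cast hk
  · have h1 : ip μ (monicOP μ n) (X ^ n) = ip μ (monicOP μ n) (monicOP μ n) := by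
      have h2 := ip_monicOP_of_degree_lt hμ n _ (monicOP_sub_degree (μ := μ) n)
      rw [ip_sub_left, sub_eq_zero] at h2
      rw [← ip_conj, ← h2, ip_conj]
    rw [hcoeff, h1, ip_self_eq, Complex.ofReal_re]

variable {D F : Wiener} {d : ℝ}

theorem tendsto_kappa (hpos : ∀ θ, 0 < w θ) (hf : ∀ θ, ev f θ = w θ) (hD : SuppGE 0 D)
    (hF : SuppGE 0 F) (hDF : D * F = 1) (hfD : f = D * star D) (hd0 : 0 < d)
    (hd : Wiener.coeff 0 D = d) :
    Tendsto (fun n => (kappa (weightMeasure w) n : ℂ)) atTop (𝓝 (d : ℂ)⁻¹) := by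
  have h := (isOPSystem_monicOP hpos hf).tendsto_norm_sq hD hF hDF hfD hd0 hd
  have h1 := h.sqrt.inv₀ (by rw [Real.sqrt_sq hd0.le]; exact hd0.ne')
  rw [Real.sqrt_sq hd0.le] at h1
  rw [← Complex.ofReal_inv]
  exact (Complex.continuous_ofReal.tendsto _).comp h1

theorem tendsto_kappa_smul_rev (hpos : ∀ θ, 0 < w θ) (hf : ∀ θ, ev f θ = w θ) (hD : SuppGE 0 D)
    (hF : SuppGE 0 F) (hDF : D * F = 1) (hfD : f = D * star D) (hd0 : 0 < d)
    (hd : Wiener.coeff 0 D = d) :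
    Tendsto (fun n : ℕ => (kappa (weightMeasure w) n : ℂ) •
      rev n (aeval (mono 1) (monicOP (weightMeasure w) n))) atTop (𝓝 F) := by
  have h1 := (tendsto_kappa hpos hf hD hF hDF hfD hd0 hd).smul
    ((isOPSystem_monicOP hpos hf).tendsto_rev hD hF hDF hfD)
  rwa [hd, smul_smul, inv_mul_cancel₀ (by exact_mod_cast hd0.ne'), one_smul] at h1

theorem continuous_star_wiener : Continuous (star : Wiener → Wiener) :=
  (LipschitzWith.of_dist_le_mul (K := 1) fun f g => by
    rw [dist_eq_norm, dist_eq_norm, ← star_sub, norm_star, NNReal.coe_one, one_mul]).continuous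

theorem phiStar_eq (μ : Measure AngleCircle) (n : ℕ) :
    phiStar μ n = ev ((kappa μ n : ℂ) • rev n (aeval (mono 1) (monicOP μ n))) := by
  funext θ
  rw [← aeval_reversed (monicOP_natDegree n).le, map_smul, ContinuousMap.smul_apply, ev_aeval,
    phiStar]
  simp [reversed, orthoPoly, reflect_C_mul]

/-- On the circle `z^{-n} φ_n` is the conjugate of `φ_n^*`, so its limit needs no separate argument.
-/
theorem phiHat_eq (μ : Measure AngleCircle) (n : ℕ) :
    phiHat μ n = ev (star ((kappa μ n : ℂ) • rev n (aeval (mono 1) (monicOP μ n)))) := by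
  funext θ
  rw [star_smul, star_rev, map_smul, map_mul, ContinuousMap.smul_apply, ContinuousMap.mul_apply,
    ev_mono, ev_aeval, phiHat, orthoPoly, eval_mul, eval_C]
  simp only [RCLike.star_def, Complex.conj_ofReal, smul_eq_mul]
  ring

theorem fPlus_eq {F : Wiener} {G : ℕ → Wiener} {μ : Measure AngleCircle}
    (h : ∀ n, phiStar μ n = ev (G n)) (hG : Tendsto G atTop (𝓝 F)) : fPlus μ = ev F := by
  funext θ
  have := ((continuous_ev_apply θ).tendsto F).comp hG
  simp only [fPlus, h]
  exact this.limUnder_eq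

theorem fMinus_eq {F : Wiener} {G : ℕ → Wiener} {μ : Measure AngleCircle}
    (h : ∀ n, phiHat μ n = ev (G n)) (hG : Tendsto G atTop (𝓝 F)) : fMinus μ = ev F := by
  funext θ
  have := ((continuous_ev_apply θ).tendsto F).comp hG
  simp only [fMinus, h]
  exact this.limUnder_eq

end Weight

namespace Wiener

/-! ### Weighted norms -/

section WeightedNorm

variable {ν : ℤ → ℝ≥0∞}

theorem wnorm_mono {f g : Wiener} (h : ∀ k, ‖coeff k f‖ₑ ≤ ‖coeff k g‖ₑ) :
    wnorm ν f ≤ wnorm ν g := ENNReal.tsum_le_tsum fun k => by gcongr; exact h k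

theorem wnorm_add_le (f g : Wiener) : wnorm ν (f + g) ≤ wnorm ν f + wnorm ν g := by
  simp only [wnorm, wsum]
  rw [← ENNReal.tsum_add]
  refine ENNReal.tsum_le_tsum fun k => ?_
  rw [← mul_add, map_add]
  gcongr
  exact enorm_add_le _ _

theorem wnorm_neg (f : Wiener) : wnorm ν (-f) = wnorm ν f := by
  simp only [wnorm, map_neg, wsum, enorm_neg]

theorem wnorm_sub_le (f g : Wiener) : wnorm ν (f - g) ≤ wnorm ν f + wnorm ν g := by
  rw [sub_eq_add_neg, ← wnorm_neg g]
  exact wnorm_add_le _ _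

theorem wnorm_zero : wnorm ν 0 = 0 := by simp [wnorm, wsum]

theorem wnorm_smul (c : ℂ) (f : Wiener) : wnorm ν (c • f) = ‖c‖ₑ * wnorm ν f := by
  simp only [wnorm, wsum, ← ENNReal.tsum_mul_left, map_smul, smul_eq_mul, enorm_mul]
  exact tsum_congr fun k => by ring

theorem wnorm_monomial (k : ℤ) : wnorm ν (mono k) = ν k := by
  rw [wnorm, wsum, tsum_eq_single k fun n hn => by simp [coeff_mono, hn]]
  simp [coeff_mono]

theorem wnorm_star (hs : ∀ k, ν (-k) = ν k) (f : Wiener) : wnorm ν (star f) = wnorm ν f := by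
  simp only [wnorm, wsum, coeff_star, RCLike.enorm_conj]
  rw [← (Equiv.neg ℤ).tsum_eq fun k => ν k * ‖coeff k f‖ₑ]
  simp [hs]

/-- Fatou's lemma for sums: convergence in the Wiener norm gives convergence of each coefficient,
and finite partial sums pass to the limit. -/
theorem wnorm_le_of_tendsto (hν : ∀ k, ν k ≠ ∞) {F : ℕ → Wiener} {f : Wiener} {C : ℝ≥0∞}
    (hF : Tendsto F atTop (𝓝 f)) (h : ∀ n, wnorm ν (F n) ≤ C) : wnorm ν f ≤ C := by
  rw [wnorm, wsum, ENNReal.tsum_eq_iSup_sum]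
  refine iSup_le fun s => ?_
  have h1 : Tendsto (fun n => ∑ k ∈ s, ν k * ‖coeff k (F n)‖ₑ) atTop
      (𝓝 (∑ k ∈ s, ν k * ‖coeff k f‖ₑ)) :=
    tendsto_finsetSum s fun k _ => ENNReal.Tendsto.const_mul
      (((continuous_coeff k).tendsto f).comp hF).enorm (Or.inr (hν k))
  exact le_of_tendsto' h1 fun n => (ENNReal.sum_le_tsum s).trans (h n)

theorem wnorm_ne_top {M : ℝ≥0∞} (hM : M ≠ ∞) (hν : ∀ k, ν k ≤ M) (f : Wiener) :
    wnorm ν f ≠ ∞ := by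
  have h : wnorm ν f ≤ M * wnorm 1 f := by
    simp only [wnorm, wsum, ← ENNReal.tsum_mul_left, Pi.one_apply, one_mul]
    exact ENNReal.tsum_le_tsum fun k => by gcongr; exact hν k
  rw [← ofReal_norm_eq] at h
  exact ne_top_of_le_ne_top (ENNReal.mul_ne_top hM ENNReal.ofReal_ne_top) h

end WeightedNorm

/-! ### The transfer matrices -/

/-- The first row `(A, B)` of the product of the transfer matrices from `N` to `j + N`; the second
row is `(conj B, conj A)`. -/
def transfer (α : ℕ → ℂ) (N : ℕ) : ℕ → Wiener × Wiener
  | 0 => (1, 0)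
  | j + 1 =>
    ((transfer α N j).1 -
        conj (α (j + N)) • (mono (-((j + N : ℕ) + 1)) * star (transfer α N j).2),
      (transfer α N j).2 -
        conj (α (j + N)) • (mono (-((j + N : ℕ) + 1)) * star (transfer α N j).1))

/-- The linear part of the second entry of `transfer`. -/
def transferLin (α : ℕ → ℂ) (N : ℕ) : ℕ → Wiener
  | 0 => 0
  | j + 1 => transferLin α N j - conj (α (j + N)) • mono (-((j + N : ℕ) + 1))

section Transfer

variable {α : ℕ → ℂ} {N : ℕ}

/-- The upper bounds do not depend on `j` and survive the limit. The lower bounds serve the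
induction, since conjugation exchanges the two ends of the support. -/
theorem transfer_supp (j : ℕ) :
    SuppLE 0 (transfer α N j).1 ∧ SuppGE (-j) (transfer α N j).1 ∧
      SuppLE (-(N + 1)) (transfer α N j).2 ∧ SuppGE (-(j + N)) (transfer α N j).2 := by
  induction j with
  | zero =>
    refine ⟨suppLE_one, by simpa [transfer] using suppGE_one, fun k _ => ?_, fun k _ => ?_⟩ <;>
    exact map_zero _
  | succ j ih =>
    obtain ⟨h1, h2, h3, h4⟩ := ih
    have e : ∀ f : Wiener, ∀ c : ℂ, -(c • f) = (-c) • f := fun f c => (neg_smul c f).symm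
    simp only [transfer, sub_eq_add_neg, e]
    refine ⟨h1.add (SuppLE.smul ?_ _), (h2.mono_le ?_).add (SuppGE.smul ?_ _),
      h3.add (SuppLE.smul ?_ _), (h4.mono_le ?_).add (SuppGE.smul ?_ _)⟩
    · exact ((suppLE_mono _).mul h4.star).mono_le (by push_cast; omega)
    · push_cast; omega
    · exact ((suppGE_mono _).mul h3.star).mono_le (by push_cast; omega)
    · exact ((suppLE_mono _).mul h2.star).mono_le (by push_cast; omega)
    · push_cast; omega
    · exact ((suppGE_mono _).mul h1.star).mono_le (by push_cast; omega)

theorem transfer_apply {P : ℕ → Wiener}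
    (hP : ∀ n : ℕ, P (n + 1) = P n - α n • (mono (n + 1) * star (P n))) (j : ℕ) :
    P (j + N) = star (transfer α N j).1 * P N + star (transfer α N j).2 * star (P N) := by
  induction j with
  | zero => simp [transfer]
  | succ j ih =>
    rw [show j + 1 + N = j + N + 1 by ring, hP, ih]
    simp only [transfer, star_sub, star_add, star_mul', star_smul, star_star, star_mono, neg_neg,
      RCLike.star_def, Complex.conj_conj]
    simp only [Algebra.smul_def]
    ring

/-- The determinant is the product of the factors `1 - |α_i|^2`; only its being a scalar matters, so
that the adjugate inverts the transfer up to a constant. -/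
theorem transfer_det (j : ℕ) : ∃ δ : ℂ, (transfer α N j).1 * star (transfer α N j).1 -
    (transfer α N j).2 * star (transfer α N j).2 = δ • 1 := by
  induction j with
  | zero => exact ⟨1, by simp [transfer]⟩
  | succ j ih =>
    obtain ⟨δ, hδ⟩ := ih
    refine ⟨(1 - conj (α (j + N)) * α (j + N)) * δ, ?_⟩
    have hm := mono_neg_mul ((j + N : ℕ) + 1)
    rw [mul_smul, ← hδ]
    simp only [transfer, star_sub, star_mul', star_smul, star_star, star_mono, neg_neg,
      RCLike.star_def, Complex.conj_conj]
    simp only [Algebra.smul_def, map_sub, map_mul, map_one]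
    set A := (transfer α N j).1
    set B := (transfer α N j).2
    set a := algebraMap ℂ Wiener (α (j + N))
    set b := algebraMap ℂ Wiener (conj (α (j + N)))
    linear_combination (a * b * (B * star B - A * star A)) * hm

/-- Applying the first row of the adjugate to `(star P_{j+N}, P_{j+N})` returns a multiple of `star
P_N`, whose support does not depend on `j`. -/
theorem transfer_relation {P : ℕ → Wiener}
    (hP : ∀ n : ℕ, P (n + 1) = P n - α n • (mono (n + 1) * star (P n)))
    (hN : SuppLE N (P N)) (j : ℕ) :
    SuppGE (-N) (star (transfer α N j).1 * star (P (j + N)) -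
      (transfer α N j).2 * P (j + N)) := by
  obtain ⟨δ, hδ⟩ := transfer_det (α := α) (N := N) j
  have h : star (transfer α N j).1 * star (P (j + N)) - (transfer α N j).2 * P (j + N) =
      δ • star (P N) := by
    rw [transfer_apply (N := N) hP, ← one_mul (star (P N)), ← smul_mul_assoc, ← hδ]
    simp only [star_add, star_mul', star_star, one_mul]
    ring
  rw [h]
  exact hN.star.smul δ

variable {ν : ℤ → ℝ≥0∞}

/-- The size of the coefficients from `N` on. -/
def tailSum (ν : ℤ → ℝ≥0∞) (α : ℕ → ℂ) (N : ℕ) : ℝ≥0∞ :=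
  ∑' i : ℕ, ν ((i + N : ℕ) + 1) * ‖α (i + N)‖ₑ

/-- Induction on `j` with partial sums in place of `tailSum`. With partial sums at most `1/4`, the
bound `‖B‖ ≤ 2 * (1/4)` gives the constant `1/2` for `A - 1`, and `‖A - 1‖ ≤ (1/4) * (1/2)` gives
`1/8` for `B` minus its linear part. The bound on `B` follows from the latter and the size of the
linear part. -/
theorem wnorm_transfer_le (hν : ∀ m n, ν (m + n) ≤ ν m * ν n) (hs : ∀ k, ν (-k) = ν k)
    (hx : tailSum ν α N ≤ 4⁻¹) (j : ℕ) :
    wnorm ν ((transfer α N j).1 - 1) ≤ tailSum ν α N * 2⁻¹ ∧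
    wnorm ν ((transfer α N j).2 - transferLin α N j) ≤ tailSum ν α N * 8⁻¹ ∧
    wnorm ν (transfer α N j).2 ≤ 2 * tailSum ν α N := by
  set β : ℕ → ℝ≥0∞ := fun i => ν ((i + N : ℕ) + 1) * ‖α (i + N)‖ₑ with hβ
  have hle : ∀ j, ∑ i ∈ Finset.range j, β i ≤ tailSum ν α N := fun j => ENNReal.sum_le_tsum _
  have h42 : (4 : ℝ≥0∞)⁻¹ * 2⁻¹ = 8⁻¹ := by
    rw [← ENNReal.mul_inv (Or.inl (by norm_num)) (Or.inl (by norm_num))]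
    norm_num
  have h24 : 2 * (4 : ℝ≥0∞)⁻¹ = 2⁻¹ := by
    rw [← ENNReal.toReal_eq_toReal_iff' (by finiteness) (by finiteness)]
    norm_num
  have hstep : ∀ j f, wnorm ν (conj (α (j + N)) • (mono (-((j + N : ℕ) + 1)) * star f)) ≤
      β j * wnorm ν f := fun j f => by
    rw [wnorm_smul, RCLike.enorm_conj, hβ]
    calc ‖α (j + N)‖ₑ * wnorm ν (mono (-((j + N : ℕ) + 1)) * star f)
        ≤ ‖α (j + N)‖ₑ * (wnorm ν (mono (-((j + N : ℕ) + 1))) * wnorm ν (star f)) := by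
          gcongr; exact wnorm_mul_le hν _ _
      _ = _ := by rw [wnorm_monomial, wnorm_star hs, hs]; ring
  have hlin : ∀ j, wnorm ν (transferLin α N j) ≤ ∑ i ∈ Finset.range j, β i := fun j => by
    induction j with
    | zero => simp [transferLin, wnorm_zero]
    | succ j ih =>
      rw [transferLin, Finset.sum_range_succ]
      refine (wnorm_sub_le _ _).trans (add_le_add ih (le_of_eq ?_))
      rw [wnorm_smul, RCLike.enorm_conj, wnorm_monomial, hs, hβ, mul_comm]
  have hB : ∀ j, wnorm ν ((transfer α N j).2 - transferLin α N j) ≤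
      (∑ i ∈ Finset.range j, β i) * 8⁻¹ →
      wnorm ν (transfer α N j).2 ≤ 2 * ∑ i ∈ Finset.range j, β i := fun j h => by
    have h1 := wnorm_add_le (ν := ν) ((transfer α N j).2 - transferLin α N j) (transferLin α N j)
    rw [sub_add_cancel] at h1
    refine h1.trans ?_
    rw [two_mul]
    refine add_le_add (h.trans (mul_le_of_le_one_right' ?_)) (hlin j)
    exact ENNReal.inv_le_one.2 (by norm_num)
  have key : ∀ j, wnorm ν ((transfer α N j).1 - 1) ≤ (∑ i ∈ Finset.range j, β i) * 2⁻¹ ∧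
      wnorm ν ((transfer α N j).2 - transferLin α N j) ≤
        (∑ i ∈ Finset.range j, β i) * 8⁻¹ := fun j => by
    induction j with
    | zero => simp [transfer, transferLin, wnorm_zero]
    | succ j ih =>
      obtain ⟨ih1, ih2⟩ := ih
      have hx' := (hle j).trans hx
      simp only [Finset.sum_range_succ, add_mul]
      constructor
      · have e : (transfer α N (j + 1)).1 - 1 = ((transfer α N j).1 - 1) -
            conj (α (j + N)) • (mono (-((j + N : ℕ) + 1)) * star (transfer α N j).2) := by
          rw [transfer]; ring
        rw [e]
        refine (wnorm_sub_le _ _).trans (add_le_add ih1 ((hstep _ _).trans ?_))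
        gcongr
        refine (hB j ih2).trans ?_
        rw [← h24]
        gcongr
      · have e : (transfer α N (j + 1)).2 - transferLin α N (j + 1) =
            ((transfer α N j).2 - transferLin α N j) -
            conj (α (j + N)) • (mono (-((j + N : ℕ) + 1)) * star ((transfer α N j).1 - 1)) := by
          rw [transfer, transferLin, star_sub, star_one]
          simp only [Algebra.smul_def]
          ring
        rw [e]
        refine (wnorm_sub_le _ _).trans (add_le_add ih2 ((hstep _ _).trans ?_))
        gcongr
        refine ih1.trans ?_
        rw [← h42]
        gcongr
  refine ⟨(key j).1.trans ?_, (key j).2.trans ?_, (hB j (key j).2).trans ?_⟩ <;>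
  gcongr <;> exact hle j

/-! ### Limits of the transfer matrices and the comparison of tails. -/

theorem exists_tendsto_of_norm_sub_le {F : ℕ → Wiener} {b : ℕ → ℝ} (hb : Summable b)
    (h : ∀ n, ‖F (n + 1) - F n‖ ≤ b n) : ∃ f, Tendsto F atTop (𝓝 f) :=
  cauchySeq_tendsto_of_complete <| cauchySeq_of_dist_le_of_summable b
    (fun n => by rw [dist_comm, dist_eq_norm]; exact h n) hb

/-- The estimates with weight `1` bound all entries by `2`, so successive entries differ by at most
`2 * ‖α (j + N)‖`, which is summable. -/
theorem exists_tendsto_transfer (hα : Summable fun n => ‖α n‖) (hx : tailSum 1 α N ≤ 4⁻¹) :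
    ∃ A B L, Tendsto (fun j => (transfer α N j).1) atTop (𝓝 A) ∧
      Tendsto (fun j => (transfer α N j).2) atTop (𝓝 B) ∧
      Tendsto (transferLin α N) atTop (𝓝 L) := by
  have hα' : Summable fun j => ‖α (j + N)‖ := (summable_nat_add_iff N).2 hα
  have hbound : ∀ j, ‖(transfer α N j).1‖ ≤ 2 ∧ ‖(transfer α N j).2‖ ≤ 2 := fun j => by
    obtain ⟨h1, -, h3⟩ := wnorm_transfer_le (ν := 1) (by simp) (by simp) hx j
    have h4 : (4 : ℝ≥0∞)⁻¹ ≤ 1 := ENNReal.inv_le_one.2 (by norm_num)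
    have h2 : (2 : ℝ≥0∞)⁻¹ ≤ 1 := ENNReal.inv_le_one.2 (by norm_num)
    have h5 : ‖(transfer α N j).1 - 1‖ ≤ 1 := by
      rw [← ENNReal.ofReal_le_one, ofReal_norm_eq]
      exact h1.trans (mul_le_one' (hx.trans h4) h2)
    have h6 : ‖(transfer α N j).2‖ ≤ 2 := by
      rw [← ENNReal.ofReal_le_ofReal_iff (by norm_num), ofReal_norm_eq]
      refine h3.trans ?_
      rw [ENNReal.ofReal_ofNat]
      exact mul_le_of_le_one_right' (hx.trans h4)
    refine ⟨?_, h6⟩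
    have := norm_add_le ((transfer α N j).1 - 1) 1
    rw [sub_add_cancel, norm_one] at this
    linarith
  have hstep : ∀ j f, ‖f‖ ≤ 2 →
      ‖conj (α (j + N)) • (mono (-((j + N : ℕ) + 1)) * star f)‖ ≤ ‖α (j + N)‖ * 2 := by
    intro j f hf
    rw [norm_smul, norm_mono_mul, norm_star, RCLike.norm_conj]
    gcongr
  obtain ⟨A, hA⟩ := exists_tendsto_of_norm_sub_le (F := fun j => (transfer α N j).1)
    (hα'.mul_right 2) fun j => by
      rw [transfer, sub_sub_cancel_left, norm_neg]
      exact hstep j _ (hbound j).2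
  obtain ⟨B, hB⟩ := exists_tendsto_of_norm_sub_le (F := fun j => (transfer α N j).2)
    (hα'.mul_right 2) fun j => by
      rw [transfer, sub_sub_cancel_left, norm_neg]
      exact hstep j _ (hbound j).1
  obtain ⟨L, hL⟩ := exists_tendsto_of_norm_sub_le (F := transferLin α N) hα' fun j => by
    rw [transferLin, sub_sub_cancel_left, norm_neg, norm_smul, norm_mono, RCLike.norm_conj, mul_one]
  exact ⟨A, B, L, hA, hB, hL⟩

theorem coeff_transferLin (i j : ℕ) (hij : i < j) :
    coeff (-((i + N : ℕ) + 1)) (transferLin α N j) = -conj (α (i + N)) := by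
  have h0 : ∀ j ≤ i, coeff (-((i + N : ℕ) + 1)) (transferLin α N j) = 0 := fun j hj => by
    induction j with
    | zero => exact map_zero _
    | succ j ih =>
      rw [transferLin, map_sub, ih (by omega), map_smul, coeff_mono, if_neg (by push_cast; omega)]
      simp
  induction j with
  | zero => omega
  | succ j ih =>
    rw [transferLin, map_sub, map_smul, coeff_mono]
    rcases eq_or_ne i j with rfl | h
    · rw [h0 i le_rfl]
      simp
    · rw [ih (by omega), if_neg (by push_cast; omega)]
      simp

/-- The coefficients `-conj α_i` stand at the distinct frequencies `-(i + 1)` in `L`, and the weight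
is symmetric. -/
theorem tailSum_le_wnorm (hs : ∀ k, ν (-k) = ν k) {L : Wiener}
    (hL : Tendsto (transferLin α N) atTop (𝓝 L)) : tailSum ν α N ≤ wnorm ν L := by
  have hc : ∀ i : ℕ, coeff (-((i + N : ℕ) + 1)) L = -conj (α (i + N)) := fun i => by
    refine tendsto_nhds_unique (((continuous_coeff _).tendsto L).comp hL) ?_
    refine tendsto_const_nhds.congr' ?_
    filter_upwards [eventually_gt_atTop i] with j hj
    exact (coeff_transferLin i j hj).symm
  have hinj : Function.Injective fun i : ℕ => -(((i + N : ℕ) : ℤ) + 1) := fun i j h => by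
    simp only at h
    omega
  refine le_trans (le_of_eq ?_)
    (ENNReal.tsum_comp_le_tsum_of_injective hinj fun k => ν k * ‖coeff k L‖ₑ)
  refine tsum_congr fun i => ?_
  rw [hc, hs, enorm_neg, RCLike.enorm_conj]

/-- Absorption into the left side. The finiteness of `x` is essential, and is why the comparison is
made for bounded weights. -/
theorem le_two_mul_of_le_add_half {x a : ℝ≥0∞} (hx : x ≠ ∞) (h : x ≤ a + x * 2⁻¹) : x ≤ 2 * a := by
  have h1 : x * 2⁻¹ + x * 2⁻¹ = x := by
    rw [← mul_add, ENNReal.inv_two_add_inv_two, mul_one]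
  have h2 : x * 2⁻¹ ≤ a := by
    refine ENNReal.le_of_add_le_add_right (a := x * 2⁻¹) ?_ (by rwa [h1])
    exact ENNReal.mul_ne_top hx (by simp)
  calc x = 2 * (x * 2⁻¹) := by rw [two_mul, h1]
    _ ≤ 2 * a := by gcongr

/-- The comparison of the tail of the Verblunsky coefficients with the tail of the negative
Fourier coefficients of the scattering function, for bounded weights. -/
theorem wnorm_tail_comparison {P : ℕ → Wiener}
    (hP : ∀ n : ℕ, P (n + 1) = P n - α n • (mono (n + 1) * star (P n)))
    (hN : SuppLE N (P N)) {D F : Wiener} {d : ℝ} (hd : d ≠ 0) (hD : SuppGE 0 D)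
    (hDF : D * F = 1) (hlim : Tendsto P atTop (𝓝 ((d : ℂ) • F)))
    (hα : Summable fun n => ‖α n‖)
    (hν : ∀ m n, ν (m + n) ≤ ν m * ν n) (hs : ∀ k, ν (-k) = ν k) (h1 : ∀ k, 1 ≤ ν k)
    {M : ℝ≥0∞} (hM : M ≠ ∞) (hνM : ∀ k, ν k ≤ M) (hx : tailSum ν α N ≤ 4⁻¹) :
    wnorm ν (proj {k | k < -(N : ℤ)} (star F * D)) ≤ 4 * tailSum ν α N ∧
      tailSum ν α N ≤ 4 * wnorm ν (proj {k | k < -(N : ℤ)} (star F * D)) := by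
  have hx1 : tailSum 1 α N ≤ 4⁻¹ := le_trans (ENNReal.tsum_le_tsum fun i => by
    gcongr; exact h1 _) hx
  have hνt : ∀ k, ν k ≠ ∞ := fun k => ne_top_of_le_ne_top hM (hνM k)
  obtain ⟨A, B, L, hA, hB, hL⟩ := exists_tendsto_transfer hα hx1
  have hest := wnorm_transfer_le hν hs hx
  have hA1 := wnorm_le_of_tendsto hνt (hA.sub_const 1) fun j => (hest j).1
  have hBL := wnorm_le_of_tendsto hνt (hB.sub hL) fun j => (hest j).2.1
  have hB1 := wnorm_le_of_tendsto hνt hB fun j => (hest j).2.2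
  have hAs : SuppLE 0 A := SuppLE.of_tendsto (fun j => (transfer_supp j).1) hA
  have hBs : SuppLE (-(N + 1)) B := SuppLE.of_tendsto (fun j => (transfer_supp j).2.2.1) hB
  set S := star F * D
  set s := proj {k | k < -(N : ℤ)} S
  -- The limit of `transfer_relation`, multiplied by `D` and divided by the real constant `d`.
  -- Multiplication by `D` does not lower the support, and it turns `star F` into `S` and `F` into
  -- `1`.
  have hrel : SuppGE (-N) (star A * S - B) := by
    have hl : Tendsto (fun j => P (j + N)) atTop (𝓝 ((d : ℂ) • F)) :=
      hlim.comp (tendsto_add_atTop_nat N)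
    have h2 : SuppGE (-N) (star A * star ((d : ℂ) • F) - B * ((d : ℂ) • F)) :=
      SuppGE.of_tendsto (transfer_relation hP hN)
        ((((continuous_star_wiener.tendsto _).comp hA).mul
          ((continuous_star_wiener.tendsto _).comp hl)).sub (hB.mul hl))
    have h3 := (hD.mul h2).smul (d : ℂ)⁻¹
    have hdc : (d : ℂ) ≠ 0 := by exact_mod_cast hd
    have h4 : (d : ℂ)⁻¹ • (D * (star A * star ((d : ℂ) • F) - B * ((d : ℂ) • F))) =
        star A * S - B := by
      rw [star_smul]
      simp only [RCLike.star_def, Complex.conj_ofReal, mul_smul_comm, ← smul_sub]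
      rw [smul_smul, inv_mul_cancel₀ hdc, one_smul]
      linear_combination (-B) * hDF
    rw [h4, zero_add] at h3
    exact h3
  -- As `star A` has nonnegative frequencies, the part of `S` from `-N` on cannot reach frequencies
  -- below `-N`.
  have hcoeff : ∀ k < -(N : ℤ), coeff k B = coeff k s + coeff k (star (A - 1) * s) := by
    intro k hk
    have h2 : SuppGE (-N) (star A * (S - s)) := by
      have := hAs.star.mul (suppGE_proj_compl_lt (-(N : ℤ)) S)
      simpa using this
    have h3 := hrel k hk
    have h4 := h2 k hk
    rw [mul_sub, map_sub, sub_eq_zero] at h4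
    rw [map_sub, sub_eq_zero, h4] at h3
    rw [← h3, ← map_add, star_sub, star_one, sub_mul, one_mul, add_sub_cancel]
  have hprod : wnorm ν (star (A - 1) * s) ≤ wnorm ν s * 8⁻¹ := by
    refine (wnorm_mul_le hν _ _).trans ?_
    rw [wnorm_star hs, mul_comm]
    gcongr
    refine hA1.trans ?_
    have h42 : (4 : ℝ≥0∞)⁻¹ * 2⁻¹ = 8⁻¹ := by
      rw [← ENNReal.mul_inv (Or.inl (by norm_num)) (Or.inl (by norm_num))]
      norm_num
    rw [← h42]
    gcongr
  have h82 : (8 : ℝ≥0∞)⁻¹ ≤ 2⁻¹ := by gcongr; norm_num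
  have h81 : (8 : ℝ≥0∞)⁻¹ ≤ 1 := ENNReal.inv_le_one.2 (by norm_num)
  constructor
  · have h2 : wnorm ν s ≤ wnorm ν (B - star (A - 1) * s) := wnorm_mono fun k => by
      rcases lt_or_ge k (-(N : ℤ)) with hk | hk
      · rw [map_sub, hcoeff k hk, add_sub_cancel_right]
      · rw [coeff_proj_of_notMem _ (by simpa using hk), enorm_zero]
        exact zero_le
    -- The term `wnorm ν s` on the right can be absorbed since `ν` is bounded and `s` lies in the
    -- Wiener algebra.
    have h3 : wnorm ν s ≤ 2 * tailSum ν α N + wnorm ν s * 2⁻¹ :=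
      (h2.trans (wnorm_sub_le _ _)).trans (add_le_add hB1 (hprod.trans (by gcongr)))
    refine (le_two_mul_of_le_add_half (wnorm_ne_top hM hνM s) h3).trans (le_of_eq ?_)
    rw [← mul_assoc]
    norm_num
  · have h2 : wnorm ν B ≤ wnorm ν (s + star (A - 1) * s) := wnorm_mono fun k => by
      rcases lt_or_ge k (-(N : ℤ)) with hk | hk
      · rw [map_add, hcoeff k hk]
      · rw [hBs k (by omega), enorm_zero]
        exact zero_le
    have h3 : wnorm ν B ≤ 2 * wnorm ν s := by
      refine (h2.trans (wnorm_add_le _ _)).trans ?_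
      rw [two_mul]
      gcongr
      exact hprod.trans (mul_le_of_le_one_right' h81)
    have h4 : wnorm ν L ≤ wnorm ν B + wnorm ν (B - L) := by
      simpa using wnorm_sub_le (ν := ν) B (B - L)
    -- Here the absorbed term is `tailSum`, finite by `hx`.
    have h5 : tailSum ν α N ≤ 2 * wnorm ν s + tailSum ν α N * 2⁻¹ :=
      (tailSum_le_wnorm hs hL).trans (h4.trans (add_le_add h3 (hBL.trans (by gcongr))))
    refine (le_two_mul_of_le_add_half (ne_top_of_le_ne_top (by simp) hx) h5).trans (le_of_eq ?_)
    rw [← mul_assoc]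
    norm_num

end Transfer
end Wiener

/-! ### Truncated weights -/

/-- The weight `ν` truncated at height `2 ^ j`. -/
def truncWeight (ν : ℤ → ℝ) (j : ℕ) : ℤ → ℝ≥0∞ := fun k => min (ENNReal.ofReal (ν k)) (2 ^ j)

section TruncWeight

variable {ν : ℤ → ℝ}

theorem one_le_truncWeight (hν : IsBeurlingWeight ν) (j : ℕ) (k : ℤ) : 1 ≤ truncWeight ν j k :=
  le_min (ENNReal.one_le_ofReal.2 (hν.one_le k)) (one_le_pow₀ (by norm_num))

theorem truncWeight_neg (hν : IsBeurlingWeight ν) (j : ℕ) (k : ℤ) :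
    truncWeight ν j (-k) = truncWeight ν j k := by
  rw [truncWeight, truncWeight, ← hν.symm]

/-- If one factor on the right is cut at `2 ^ j`, the product is already at least `2 ^ j`, because
the other factor is at least `1`. -/
theorem truncWeight_add_le (hν : IsBeurlingWeight ν) (j : ℕ) (m n : ℤ) :
    truncWeight ν j (m + n) ≤ truncWeight ν j m * truncWeight ν j n := by
  rcases le_total (ENNReal.ofReal (ν m)) (2 ^ j) with hm | hm
  · rcases le_total (ENNReal.ofReal (ν n)) (2 ^ j) with hn | hn
    · have h0 : 0 ≤ ν m := zero_le_one.trans (hν.one_le m)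
      rw [truncWeight, truncWeight, truncWeight, min_eq_left hm, min_eq_left hn,
        ← ENNReal.ofReal_mul h0]
      exact (min_le_left _ _).trans (ENNReal.ofReal_le_ofReal (hν.submul m n))
    · calc truncWeight ν j (m + n) ≤ 2 ^ j := min_le_right _ _
        _ = truncWeight ν j n := (min_eq_right hn).symm
        _ ≤ _ := le_mul_of_one_le_left' (one_le_truncWeight hν j m)
  · calc truncWeight ν j (m + n) ≤ 2 ^ j := min_le_right _ _
      _ = truncWeight ν j m := (min_eq_right hm).symm
      _ ≤ _ := le_mul_of_one_le_right' (one_le_truncWeight hν j n)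

/-- The reason for truncating at powers of `2`: passing to the next height costs a bounded factor.
-/
theorem truncWeight_succ_le (j : ℕ) (k : ℤ) :
    truncWeight ν (j + 1) k ≤ 2 * truncWeight ν j k := by
  rw [truncWeight, truncWeight, mul_min]
  refine min_le_min ?_ (le_of_eq (pow_succ' 2 j))
  rw [two_mul]
  exact le_add_self

/-- Monotone convergence: on a finite set of indices the truncation is inactive once `j` is large.
-/
theorem tsum_mul_le_of_min {ι : Type*} {a b : ι → ℝ≥0∞} {C : ℝ≥0∞} (ha : ∀ k, a k ≠ ∞)
    (h : ∀ j : ℕ, ∑' k, min (a k) (2 ^ j) * b k ≤ C) : ∑' k, a k * b k ≤ C := by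
  rw [ENNReal.tsum_eq_iSup_sum]
  refine iSup_le fun s => ?_
  obtain ⟨j, hj⟩ := ENNReal.exists_nat_gt (ENNReal.sum_ne_top.2 fun k (_ : k ∈ s) => ha k)
  have h2 : (j : ℝ≥0∞) ≤ 2 ^ j := by exact_mod_cast Nat.lt_two_pow_self.le
  refine le_trans (Finset.sum_le_sum fun k hk => ?_) ((ENNReal.sum_le_tsum s).trans (h j))
  rw [min_eq_left]
  exact ((Finset.single_le_sum (fun _ _ => zero_le) hk).trans hj.le).trans h2

end TruncWeight

/-! ### Summability in terms of weighted sums -/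

theorem ofReal_mul_norm {x : ℝ} (hx : 0 ≤ x) (z : ℂ) :
    ENNReal.ofReal (x * ‖z‖) = ENNReal.ofReal x * ‖z‖ₑ := by
  rw [ENNReal.ofReal_mul hx, ofReal_norm]

theorem summable_iff_tsum_enorm_ne_top {ι : Type*} {x : ι → ℝ} {z : ι → ℂ} (hx : ∀ k, 0 ≤ x k) :
    Summable (fun k => x k * ‖z k‖) ↔ ∑' k, ENNReal.ofReal (x k) * ‖z k‖ₑ ≠ ∞ := by
  simp only [← ofReal_mul_norm (hx _)]
  refine ⟨fun h => h.tsum_ofReal_ne_top, fun h => ?_⟩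
  refine (ENNReal.summable_toReal h).congr fun k => ?_
  rw [ENNReal.toReal_ofReal (mul_nonneg (hx k) (norm_nonneg _))]

/-- In the transfer matrices `α n` belongs to the frequency `-(n + 1)`, whence the shifted weight;
submultiplicativity bounds the cost of the shift by `ν 1` in both directions. -/
theorem memEll_zeroExtend_iff {ν : ℤ → ℝ} (hν : IsBeurlingWeight ν) (α : ℕ → ℂ) :
    MemEll ν (zeroExtend α) ↔ Summable fun n : ℕ => ν (n + 1) * ‖α n‖ := by
  have h0 : ∀ k, 0 ≤ ν k := fun k => zero_le_one.trans (hν.one_le k)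
  have h1 : MemEll ν (zeroExtend α) ↔ Summable fun n : ℕ => ν n * ‖α n‖ := by
    rw [MemEll, ← Function.Injective.summable_iff (f := fun k => ν k * ‖zeroExtend α k‖)
      (Nat.cast_injective (R := ℤ))]
    · refine summable_congr fun n => ?_
      simp [zeroExtend]
    · intro k hk
      rw [zeroExtend, if_neg, norm_zero, mul_zero]
      exact fun h => hk ⟨k.toNat, Int.toNat_of_nonneg h⟩
  rw [h1]
  constructor <;> intro h
  · refine (h.mul_left (ν 1)).of_nonneg_of_le (fun n => mul_nonneg (h0 _) (norm_nonneg _))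
      fun n => ?_
    rw [← mul_assoc, mul_comm (ν 1)]
    gcongr
    exact hν.submul n 1
  · refine (h.mul_left (ν 1)).of_nonneg_of_le (fun n => mul_nonneg (h0 _) (norm_nonneg _))
      fun n => ?_
    rw [← mul_assoc, mul_comm (ν 1), hν.symm 1]
    gcongr
    simpa using hν.submul (n + 1) (-1)

/-- The two projections differ only at the finitely many frequencies `-N, …, 0`. -/
theorem summable_proj_of_wnorm_tail {ν : ℤ → ℝ} (hν : ∀ k, 0 ≤ ν k) {S : Wiener} {N : ℕ}
    (h : wnorm (fun k => ENNReal.ofReal (ν k)) (proj {k | k < -(N : ℤ)} S) ≠ ∞) :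
    Summable fun k => ν k * ‖Wiener.coeff k (proj {k | k ≤ 0} S)‖ := by
  have h1 := (summable_iff_tsum_enorm_ne_top hν).2 h
  refine (summable_congr_cofinite ?_).1 h1
  refine (Set.finite_Icc (-(N : ℤ)) 0).subset fun k hk => ?_
  by_contra hk'
  refine hk ?_
  change ν k * _ = ν k * _
  rw [Set.mem_Icc, not_and_or, not_le, not_le] at hk'
  rcases hk' with hk' | hk'
  · rw [coeff_proj_of_mem (s := {k | k < -(N : ℤ)}) _ hk',
      coeff_proj_of_mem (s := {k | k ≤ 0}) _ (show k ≤ 0 by omega)]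
  · rw [coeff_proj_of_notMem, coeff_proj_of_notMem]
    · simpa using hk'
    · simp only [Set.mem_ofPred_eq]
      omega

theorem tendsto_wnorm_tail {ν : ℤ → ℝ} (hν : ∀ k, 0 ≤ ν k) {S : Wiener}
    (h : Summable fun k => ν k * ‖Wiener.coeff k (proj {k | k ≤ 0} S)‖) :
    Tendsto (fun N : ℕ => wnorm (fun k => ENNReal.ofReal (ν k)) (proj {k | k < -(N : ℤ)} S))
      atTop (𝓝 0) := by
  have h1 := ENNReal.tendsto_ofReal (tendsto_tsum_indicator_lt_neg h
    fun k => mul_nonneg (hν k) (norm_nonneg _))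
  rw [ENNReal.ofReal_zero] at h1
  refine h1.congr fun N => ?_
  rw [ENNReal.ofReal_tsum_of_nonneg
    (fun k => Set.indicator_nonneg (fun k _ => mul_nonneg (hν k) (norm_nonneg _)) k)
    (h.indicator _), wnorm, wsum]
  refine tsum_congr fun k => ?_
  rcases lt_or_ge k (-(N : ℤ)) with hk | hk
  · rw [Set.indicator_of_mem (s := {k : ℤ | k < -(N : ℤ)}) hk, ofReal_mul_norm (hν k),
      coeff_proj_of_mem (s := {k | k < -(N : ℤ)}) _ hk,
      coeff_proj_of_mem (s := {k | k ≤ 0}) _ (show k ≤ 0 by omega)]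
  · have hk' : k ∉ {k : ℤ | k < -(N : ℤ)} := by simpa using hk
    rw [Set.indicator_of_notMem hk', coeff_proj_of_notMem _ hk', ENNReal.ofReal_zero, enorm_zero,
      mul_zero]

theorem tendsto_tailSum {ν : ℤ → ℝ≥0∞} {α : ℕ → ℂ}
    (h : ∑' n : ℕ, ν (n + 1) * ‖α n‖ₑ ≠ ∞) : Tendsto (tailSum ν α) atTop (𝓝 0) :=
  ENNReal.tendsto_sum_nat_add _ h

/-- The Verblunsky coefficients are in a weighted `ℓ¹` space if and only if the negative Fourier
coefficients of the scattering function are. -/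
theorem summable_weighted_iff {ν : ℤ → ℝ} (hν : IsBeurlingWeight ν) {α : ℕ → ℂ} {P : ℕ → Wiener}
    (hP : ∀ n : ℕ, P (n + 1) = P n - α n • (mono (n + 1) * star (P n)))
    (hN : ∀ N : ℕ, SuppLE N (P N)) {D F : Wiener} {d : ℝ} (hd : d ≠ 0) (hD : SuppGE 0 D)
    (hDF : D * F = 1) (hlim : Tendsto P atTop (𝓝 ((d : ℂ) • F)))
    (hα : Summable fun n => ‖α n‖) :
    (Summable fun n : ℕ => ν (n + 1) * ‖α n‖) ↔
      Summable fun k => ν k * ‖Wiener.coeff k (proj {k | k ≤ 0} (star F * D))‖ := by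
  have h0 : ∀ k, 0 ≤ ν k := fun k => zero_le_one.trans (hν.one_le k)
  set S := star F * D
  set μ : ℤ → ℝ≥0∞ := fun k => ENNReal.ofReal (ν k) with hμ
  have cmp : ∀ N j, tailSum (truncWeight ν j) α N ≤ 4⁻¹ →
      wnorm (truncWeight ν j) (proj {k | k < -(N : ℤ)} S) ≤ 4 * tailSum (truncWeight ν j) α N ∧
      tailSum (truncWeight ν j) α N ≤ 4 * wnorm (truncWeight ν j) (proj {k | k < -(N : ℤ)} S) :=
    fun N j hx => wnorm_tail_comparison hP (hN N) hd hD hDF hlim hα (truncWeight_add_le hν j)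
      (truncWeight_neg hν j) (one_le_truncWeight hν j) (M := 2 ^ j) (by finiteness)
      (fun k => min_le_right _ _) hx
  have h4 : (0 : ℝ≥0∞) < 4⁻¹ := by simp
  constructor
  · intro h
    have h1 := (summable_iff_tsum_enorm_ne_top fun n : ℕ => h0 (n + 1)).1 h
    -- This `N` is chosen for `ν` itself and so serves all truncations at once, giving a bound
    -- uniform in `j`.
    obtain ⟨N, hN'⟩ := ((tendsto_tailSum (ν := μ) h1).eventually_le_const h4).exists
    refine summable_proj_of_wnorm_tail h0 (N := N) (ne_top_of_le_ne_top (b := 4 * 4⁻¹)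
      (by finiteness) ?_)
    refine tsum_mul_le_of_min (fun k => ENNReal.ofReal_ne_top) fun j => ?_
    have hx : tailSum (truncWeight ν j) α N ≤ 4⁻¹ := le_trans (ENNReal.tsum_le_tsum fun i => by
      gcongr; exact min_le_left _ _) hN'
    exact (cmp N j hx).1.trans (by gcongr)
  · intro h
    have h1 : ∑' n : ℕ, (1 : ℤ → ℝ≥0∞) (n + 1) * ‖α n‖ₑ ≠ ∞ := by
      have := (summable_iff_tsum_enorm_ne_top (x := fun _ : ℕ => (1 : ℝ)) (z := α)
        fun _ => zero_le_one).1 (by simpa using hα)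
      simpa using this
    have h32 : (0 : ℝ≥0∞) < 32⁻¹ := by simp
    -- The start `j = 0` of the bootstrap has weight `1` and is supplied by Baxter's theorem. The
    -- value `1/32` is chosen so that `2 * (4 * (1/32)) = 1/4`, as verified in `hc`.
    obtain ⟨N, hx, hs⟩ := (((tendsto_tailSum (ν := 1) h1).eventually_le_const h4).and
      ((tendsto_wnorm_tail h0 h).eventually_le_const h32)).exists
    have hc : 2 * (4 * (32 : ℝ≥0∞)⁻¹) = 4⁻¹ := by
      rw [← ENNReal.toReal_eq_toReal_iff' (by finiteness) (by finiteness)]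
      norm_num
    -- The comparison at height `2 ^ j` improves the bound `1/4` to `1/8`, and doubling the height
    -- loses at most a factor `2`.
    have key : ∀ j, tailSum (truncWeight ν j) α N ≤ 4⁻¹ := fun j => by
      induction j with
      | zero =>
        refine le_trans (ENNReal.tsum_le_tsum fun i => ?_) hx
        gcongr
        exact (min_le_right _ _).trans (by simp)
      | succ j ih =>
        have h2 : tailSum (truncWeight ν (j + 1)) α N ≤ 2 * tailSum (truncWeight ν j) α N := by
          rw [tailSum, tailSum, ← ENNReal.tsum_mul_left]
          refine ENNReal.tsum_le_tsum fun i => ?_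
          rw [← mul_assoc]
          gcongr
          exact truncWeight_succ_le j _
        have h3 : wnorm (truncWeight ν j) (proj {k | k < -(N : ℤ)} S) ≤ 32⁻¹ :=
          le_trans (ENNReal.tsum_le_tsum fun k => by gcongr; exact min_le_left _ _) hs
        calc tailSum (truncWeight ν (j + 1)) α N ≤ 2 * tailSum (truncWeight ν j) α N := h2
          _ ≤ 2 * (4 * 32⁻¹) := by gcongr; exact (cmp N j ih).2.trans (by gcongr)
          _ = 4⁻¹ := hc
    have h5 : tailSum μ α N ≤ 4⁻¹ :=
      tsum_mul_le_of_min (fun i => ENNReal.ofReal_ne_top) key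
    rw [← summable_nat_add_iff N]
    refine (summable_iff_tsum_enorm_ne_top fun n : ℕ => h0 ((n + N : ℕ) + 1)).2 ?_
    exact ne_top_of_le_ne_top (by simp) h5

end

end OPUC

/-! ### The main theorem. -/

open OPUC OPUC.Wiener in
theorem mainTheorem2 (w : OPUC.AngleCircle → ℝ) (hpos : ∀ θ, 0 < w θ)
    (hw : OPUC.MemA (fun _ => 1) (fun θ => (w θ : ℂ)))
    (ν : ℤ → ℝ) (hν : OPUC.IsBeurlingWeight ν) :
    -- the limits defining `f_+` and `f_-` exist in the Wiener algebra, `f_+` has no zeros on the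
    -- circle, and `S = f_- / f_+` is in the Wiener algebra
    OPUC.TendstoA (fun _ => 1) (OPUC.phiStar (OPUC.weightMeasure w))
      (OPUC.fPlus (OPUC.weightMeasure w)) ∧
    OPUC.TendstoA (fun _ => 1) (OPUC.phiHat (OPUC.weightMeasure w))
      (OPUC.fMinus (OPUC.weightMeasure w)) ∧
    (∀ θ, OPUC.fPlus (OPUC.weightMeasure w) θ ≠ 0) ∧
    OPUC.MemA (fun _ => 1) (OPUC.scattering (OPUC.weightMeasure w)) ∧
    -- the equivalence
    (OPUC.MemEll ν (OPUC.zeroExtend (OPUC.verblunsky (OPUC.weightMeasure w))) ↔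
      OPUC.MemAMinus ν (OPUC.projMinus (OPUC.scattering (OPUC.weightMeasure w)))) := by
  obtain ⟨f, hf⟩ := exists_wiener_of_memA hw
  obtain ⟨D, F, hD, hF, hDF, hfD, d, hd0, hd⟩ := exists_factorization hpos hf
  have hsys := isOPSystem_monicOP hpos hf
  have hlim := tendsto_kappa_smul_rev hpos hf hD hF hDF hfD hd0 hd
  have hlim' := (continuous_star_wiener.tendsto F).comp hlim
  have hplus := fPlus_eq (phiStar_eq (weightMeasure w)) hlim
  have hminus := fMinus_eq (phiHat_eq (weightMeasure w)) hlim'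
  have hDFev : ∀ θ, ev D θ * ev F θ = 1 := fun θ => by
    rw [← ContinuousMap.mul_apply, ← map_mul, hDF, map_one, ContinuousMap.one_apply]
  -- Since `F` is the inverse of `D`, the quotient `star F / F` is a product in the Wiener algebra.
  have hscat : scattering (weightMeasure w) = ev (star F * D) := funext fun θ => by
    rw [scattering, hplus, hminus, map_mul, ContinuousMap.mul_apply,
      eq_inv_of_mul_eq_one_left (hDFev θ), div_eq_mul_inv]
  refine ⟨?_, ?_, fun θ => ?_, ?_, ?_⟩
  · rw [hplus, funext (phiStar_eq (weightMeasure w))]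
    exact tendstoA_ev hlim
  · rw [hminus, funext (phiHat_eq (weightMeasure w))]
    exact tendstoA_ev hlim'
  · rw [hplus]
    exact right_ne_zero_of_mul (hDFev θ ▸ one_ne_zero)
  · rw [hscat]
    exact memA_one_ev _
  · rw [memEll_zeroExtend_iff hν, hscat, memAMinus_projMinus_ev_iff]
    -- The comparison is applied to the monic `Φ_n^*`, whose recurrence carries no normalizing
    -- factor; their limit is `d • F`.
    exact summable_weighted_iff hν hsys.rev_succ hsys.rev_suppLE hd0.ne' hD hDF
      (hd ▸ hsys.tendsto_rev hD hF hDF hfD) (hsys.summable_norm hD hF hDF hfD)
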